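/- Let $p$ be an odd prime, $n>1$ an integer and $q=p^{n-1}$. Let $G$ be the universal $p$-typical formal group law over $\mathbf Z_p[v_1,v_2,\dots]$ with Araki's generators, that is, the formal group law with logarithm $\sum_{k\ge 0}\ell_k x^{p^k}$, where $\ell_0=1$ and $p\,\ell_k=\sum_{i=0}^{k}\ell_i\,v_{k-i}^{p^i}$ with $v_0=p$. Let $F_0$ be the formal group law over $\mathbf F_p[y^{-1}]$ obtained from $G$ by reduction modulo $p$ and the specialisation $v_{n-1}\mapsto 1$, $v_n\mapsto -y^{(1-p)q}$, $v_i\mapsto 0$ for $i\ne n-1,n$; let $H$ be the Honda formal group law of height $n-1$ over $\mathbf F_p$, obtained from $G$ by reduction modulo $p$ and $v_{n-1}\mapsto 1$, $v_i\mapsto 0$ for $i\neq n-1$. Their $p$-series satisfy $$[p]_{F_0}(t)=t^q-_{F_0}y^{(1-p)q}t^{pq},\qquad [p]_H(t)=t^q .$$ For a field $K$ write $K^{s}$ for its separable closure. Expansion at $y=\infty$ is the embedding $\mathbf F_p(y)\to\mathbf F_p((y^{-1}))$; let $\iota:\mathbf F_p(y)^{s}\to\mathbf F_p((y^{-1}))^{s}$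 be any extension of it. Expansion at $y=0$ is the embedding $\mathbf F_p(y)\to\mathbf F_p((y))$; let $\iota_0:\mathbf F_p(y)^{s}\to\mathbf F_p((y))^{s}$ be any extension of it. (a) There is a unique isomorphism $\Phi:F_0\to H$ of formal group laws over $\mathbf F_p(y)^{s}$ such that the image of $\Phi$ under $\iota$ has coefficients in $\mathbf F_p[[y^{-1}]]$ and satisfies $\Phi(t)\equiv t \bmod y^{-1}$. This $\Phi$ is strict (that is, $\Phi(t)\equiv t\bmod t^2$), and its image is a strict isomorphism $F_0\to H$ over $\mathbf F_p[[y^{-1}]]$. (b) There is a unique strict isomorphism $\Psi:F_0\to H$ over $\mathbf F_p((y))^{s}$ such that $\Psi$ is the image under $\iota_0$ of a power series $\Phi$ with coefficients in $\mathbf F_p(y)^{s}$, and the image of $\Phi$ under $\iota$ has coefficients in $\mathbf F_p[[y^{-1}]]$ and is congruent to the identity modulo $y^{-1}$. -/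

import Mathlib

namespace ChromaticFGL

open MvPowerSeries

section PTypical
variable {R : Type*} [CommRing R]

/-- The power series `∑ₖ a k * x ^ (p ^ k)`. -/
noncomputable def pSeriesOf (p : ℕ) (a : ℕ → R) : PowerSeries R :=
  PowerSeries.mk fun m => if m = p ^ Nat.log p m then a (Nat.log p m) else 0

lemma coeff_pSeriesOf_pow {p : ℕ} (hp : 1 < p) (a : ℕ → R) (k : ℕ) :
    (pSeriesOf p a).coeff (p ^ k) = a k := by
  simp [pSeriesOf, Nat.log_pow hp]

lemma coeff_pSeriesOf_of_ne {p : ℕ} (a : ℕ → R) {m : ℕ} (hm : ∀ k, m ≠ p ^ k) :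
    (pSeriesOf p a).coeff m = 0 := by
  simp [pSeriesOf, hm]

lemma map_pSeriesOf {S : Type*} [CommRing S] (p : ℕ) (a : ℕ → R) (f : R →+* S) :
    (pSeriesOf p a).map f = pSeriesOf p (fun k => f (a k)) := by
  ext m
  simp only [PowerSeries.coeff_map, pSeriesOf, PowerSeries.coeff_mk]
  split_ifs <;> simp

lemma constantCoeff_pSeriesOf {p : ℕ} (hp : 1 < p) (a : ℕ → R) :
    (pSeriesOf p a).constantCoeff = 0 := by
  rw [← PowerSeries.coeff_zero_eq_constantCoeff_apply]
  exact coeff_pSeriesOf_of_ne a fun k => (pow_pos (by omega) k).ne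

lemma coeff_one_pSeriesOf {p : ℕ} (hp : 1 < p) (a : ℕ → R) :
    (pSeriesOf p a).coeff 1 = a 0 := by
  simpa using coeff_pSeriesOf_pow hp a 0

lemma coeff_pow_eq_zero {τ : Type*} {G : MvPowerSeries τ R} (hG : G.constantCoeff = 0)
    {e : τ →₀ ℕ} {r : ℕ} (h : e.degree < r) : coeff e (G ^ r) = 0 := by
  apply coeff_of_lt_order
  exact lt_of_lt_of_le (by exact_mod_cast h) (le_order_pow_of_constantCoeff_eq_zero r hG)

lemma coeff_subst_pSeriesOf {p : ℕ} (hp : 1 < p) (a : ℕ → R) {τ : Type*}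
    {G : MvPowerSeries τ R} (hG : G.constantCoeff = 0) {e : τ →₀ ℕ} {N : ℕ} (hN : e.degree < N) :
    coeff e ((pSeriesOf p a).subst G) = ∑ k ∈ Finset.range N, a k * coeff e (G ^ p ^ k) := by
  classical
  rw [PowerSeries.coeff_subst (PowerSeries.HasSubst.of_constantCoeff_zero hG)]
  rw [finsum_eq_sum_of_support_subset (s := (Finset.range N).image (fun k => p ^ k))]
  · rw [Finset.sum_image]
    · exact Finset.sum_congr rfl fun k _ => by rw [coeff_pSeriesOf_pow hp, smul_eq_mul]
    · intro x _ y _ h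
      exact Nat.pow_right_injective hp h
  · intro m hm
    rw [Function.mem_support] at hm
    by_cases h : ∃ k, m = p ^ k
    · obtain ⟨k, rfl⟩ := h
      simp only [Finset.coe_image, Finset.coe_range, Set.mem_image, Set.mem_Iio]
      refine ⟨k, ?_, rfl⟩
      by_contra hk
      apply hm
      rw [coeff_pow_eq_zero hG, smul_zero]
      exact lt_of_lt_of_le hN ((not_lt.mp hk).trans (Nat.lt_pow_self hp).le)
    · push Not at h
      rw [coeff_pSeriesOf_of_ne a h, zero_smul] at hm
      exact absurd rfl hm

end PTypical

section Twisted
variable {R : Type*} [CommRing R] {τ : Type*}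

/-- The endomorphism of a power series ring that applies `s` to the coefficients and raises the
variables to the `p`-th power. -/
noncomputable def frobTwist (p : ℕ) (hp : p ≠ 0) (s : R →+* R) :
    MvPowerSeries τ R →+* MvPowerSeries τ R :=
  (MvPowerSeries.map s).comp (MvPowerSeries.expand p hp).toRingHom

variable {p : ℕ} (hp : p ≠ 0) (s : R →+* R)

lemma frobTwist_apply (G : MvPowerSeries τ R) :
    frobTwist p hp s G = (MvPowerSeries.expand p hp G).map s := rfl

lemma constantCoeff_frobTwist {G : MvPowerSeries τ R} (hG : G.constantCoeff = 0) :
    (frobTwist p hp s G).constantCoeff = 0 := by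
  rw [frobTwist_apply, MvPowerSeries.constantCoeff_map, constantCoeff_expand, hG, map_zero]

lemma constantCoeff_frobTwist_iterate {G : MvPowerSeries τ R} (hG : G.constantCoeff = 0) (i : ℕ) :
    ((frobTwist p hp s)^[i] G).constantCoeff = 0 := by
  induction i with
  | zero => simpa
  | succ i ih => rw [Function.iterate_succ_apply']; exact constantCoeff_frobTwist hp s ih

lemma le_order_frobTwist (G : MvPowerSeries τ R) : p • G.order ≤ (frobTwist p hp s G).order := by
  rw [frobTwist_apply, ← order_expand p hp]
  exact le_order_map _

lemma frobTwist_subst (a : ℕ → R) {G : MvPowerSeries τ R} (hG : G.constantCoeff = 0) :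
    frobTwist p hp s ((pSeriesOf p a).subst G) =
      (pSeriesOf p fun k => s (a k)).subst (frobTwist p hp s G) := by
  have h := PowerSeries.HasSubst.of_constantCoeff_zero hG
  rw [frobTwist_apply, PowerSeries.expand_subst p hp h, PowerSeries.map_subst, map_pSeriesOf,
    frobTwist_apply]
  apply PowerSeries.HasSubst.of_constantCoeff_zero
  rw [constantCoeff_expand, hG]

lemma frobTwist_iterate_subst (a : ℕ → R) {G : MvPowerSeries τ R} (hG : G.constantCoeff = 0)
    (i : ℕ) : (frobTwist p hp s)^[i] ((pSeriesOf p a).subst G) =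
      (pSeriesOf p fun k => s^[i] (a k)).subst ((frobTwist p hp s)^[i] G) := by
  induction i with
  | zero => rfl
  | succ i ih =>
    simp only [Function.iterate_succ_apply', ih]
    rw [frobTwist_subst hp s _ (constantCoeff_frobTwist_iterate hp s hG i)]

lemma frobTwist_X (j : τ) : frobTwist p hp s (X j) = X j ^ p := by
  rw [frobTwist_apply, expand_X]; simp

lemma frobTwist_iterate_X (j : τ) (i : ℕ) : (frobTwist p hp s)^[i] (X j) = X j ^ p ^ i := by
  induction i with
  | zero => simp
  | succ i ih => rw [Function.iterate_succ_apply', ih, map_pow, frobTwist_X, ← pow_mul, pow_succ']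

lemma natCast_dvd_of_map_mk_eq_zero {G : MvPowerSeries τ R}
    (h : G.map (Ideal.Quotient.mk (Ideal.span {(p : R)})) = 0) :
    (p : MvPowerSeries τ R) ∣ G := by
  have : ∀ d, ∃ c, coeff d G = p * c := fun d => by
    have := congrArg (coeff d) h
    rw [MvPowerSeries.coeff_map, map_zero, Ideal.Quotient.eq_zero_iff_mem,
      Ideal.mem_span_singleton] at this
    exact this
  choose c hc using this
  obtain ⟨c', hc'⟩ : ∃ c' : MvPowerSeries τ R, ∀ d, coeff d c' = c d := ⟨c, fun _ => rfl⟩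
  refine ⟨c', ?_⟩
  ext d
  have h2 : (p : MvPowerSeries τ R) = C (p : R) := by simp
  rw [hc, h2, coeff_C_mul, hc']

lemma frobTwist_sub_pow [Fact p.Prime] (hs : ∀ a, (p : R) ∣ s a - a ^ p) (G : MvPowerSeries τ R) :
    (p : MvPowerSeries τ R) ∣ frobTwist p hp s G - G ^ p := by
  by_cases hu : IsUnit (p : R)
  · have h2 : (p : MvPowerSeries τ R) = C (p : R) := by simp
    exact (h2 ▸ hu.map (C (σ := τ))).dvd
  · have : CharP (R ⧸ Ideal.span {(p : R)}) p := CharP.quotient R p hu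
    have : ExpChar (R ⧸ Ideal.span {(p : R)}) p := ExpChar.prime Fact.out
    apply natCast_dvd_of_map_mk_eq_zero
    rw [map_sub, map_pow, ← map_frobenius_expand p hp, sub_eq_zero, frobTwist_apply,
      ← map_expand]
    ext d
    simp only [MvPowerSeries.coeff_map, frobenius_def]
    rw [← map_pow, Ideal.Quotient.eq, Ideal.mem_span_singleton]
    exact hs _

lemma frobTwist_iterate_sub_pow [Fact p.Prime] (hs : ∀ a, (p : R) ∣ s a - a ^ p)
    (G : MvPowerSeries τ R) (i : ℕ) :
    (p : MvPowerSeries τ R) ∣ (frobTwist p hp s)^[i] G - G ^ p ^ i := by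
  induction i with
  | zero => simp
  | succ i ih =>
    rw [Function.iterate_succ_apply']
    have h1 := map_dvd (frobTwist p hp s) ih
    rw [map_natCast, map_sub, map_pow] at h1
    have h2 : (p : MvPowerSeries τ R) ∣ (frobTwist p hp s G) ^ p ^ i - (G ^ p) ^ p ^ i :=
      (frobTwist_sub_pow hp s hs G).trans (sub_dvd_pow_sub_pow _ _ _)
    have := dvd_add h1 h2
    rwa [sub_add_sub_cancel, ← pow_mul, ← pow_succ'] at this

lemma frobTwist_pow_sub_pow [Fact p.Prime] (hs : ∀ a, (p : R) ∣ s a - a ^ p)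
    (G : MvPowerSeries τ R) (i k : ℕ) :
    (p : MvPowerSeries τ R) ^ (k + 1) ∣
      ((frobTwist p hp s)^[i] G) ^ p ^ k - G ^ p ^ (i + k) := by
  have := dvd_sub_pow_of_dvd_sub (frobTwist_iterate_sub_pow hp s hs G i) k
  rwa [← pow_mul, ← pow_add] at this

end Twisted

section Approx
variable {R : Type*} [CommRing R] {τ : Type*}

lemma order_pow_sub_pow {G H : MvPowerSeries τ R} (hG : G.constantCoeff = 0)
    (hH : H.constantCoeff = 0) {m : ℕ} (h : (m : ℕ∞) ≤ (G - H).order) {r : ℕ} (hr : 2 ≤ r) :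
    ((m + 1 : ℕ) : ℕ∞) ≤ (G ^ r - H ^ r).order := by
  rw [← (Commute.all G H).geom_sum₂_mul]
  refine le_trans ?_ le_order_mul
  rw [Nat.cast_add, add_comm]
  gcongr
  rw [Nat.cast_one, one_le_order_iff_constCoeff_eq_zero, map_sum]
  refine Finset.sum_eq_zero fun i hi => ?_
  rw [map_mul, map_pow, map_pow, hG, hH]
  rcases Nat.eq_zero_or_pos i with rfl | h0
  · rw [zero_pow (n := r - 1 - 0) (by omega), mul_zero]
  · rw [zero_pow h0.ne', zero_mul]

lemma order_pow_sub_pow' {G H : MvPowerSeries τ R} {m : ℕ∞} (h : m ≤ (G - H).order) (r : ℕ) :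
    m ≤ (G ^ r - H ^ r).order := by
  obtain ⟨c, hc⟩ := sub_dvd_pow_sub_pow G H r
  rw [hc]
  exact h.trans (le_trans le_self_add le_order_mul)

lemma coeff_eq_of_lt_order_sub {G H : MvPowerSeries τ R} {m : ℕ} {e : τ →₀ ℕ}
    (h : ((m + 1 : ℕ) : ℕ∞) ≤ (G - H).order) (he : e.degree = m) : coeff e G = coeff e H := by
  rw [← sub_eq_zero, ← map_sub]
  apply coeff_of_lt_order
  refine lt_of_lt_of_le ?_ h
  rw [he]
  exact_mod_cast Nat.lt_succ_self m

end Approx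

section FunctionalEquation

variable {A K : Type*} [CommRing A] [CommRing K] {p : ℕ}

/-- The coefficientwise form of `p ℓ(G) = p G + ∑ᵢ sᵢ ℓ^{σⁱ}(G^{pⁱ})`. -/
lemma coeff_functional_equation (hp : 1 < p) (s ℓ : ℕ → K) (σ : K →+* K)
    (h0 : ℓ 0 = 1)
    (hℓ : ∀ k, p * ℓ (k + 1) = ∑ i ∈ Finset.range (k + 1), s i * σ^[i + 1] (ℓ (k - i)))
    {τ : Type*} {G : MvPowerSeries τ K} (hG : G.constantCoeff = 0) {e : τ →₀ ℕ} {N : ℕ}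
    (hN : e.degree < N) :
    p * coeff e ((pSeriesOf p ℓ).subst G) = p * coeff e G +
      ∑ i ∈ Finset.range N, s i *
        coeff e ((pSeriesOf p fun k => σ^[i + 1] (ℓ k)).subst (G ^ p ^ (i + 1))) := by
  have hGi : ∀ i, (G ^ p ^ (i + 1)).constantCoeff = 0 := fun i => by
    rw [map_pow, hG, zero_pow (pow_pos (by omega) _).ne']
  rw [coeff_subst_pSeriesOf hp ℓ hG (Nat.lt_succ_of_lt hN), Finset.sum_range_succ', mul_add,
    add_comm, h0, pow_zero, pow_one, one_mul]
  congr 1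
  have hz : ∀ j, N ≤ j → coeff e (G ^ p ^ (j + 1)) = 0 := fun j hj =>
    coeff_pow_eq_zero hG (lt_of_lt_of_le hN (hj.trans
      ((Nat.le_succ _).trans (Nat.lt_pow_self hp).le)))
  simp_rw [coeff_subst_pSeriesOf hp _ (hGi _) hN, ← pow_mul, ← pow_add, Finset.mul_sum]
  simp_rw [← mul_assoc, hℓ, Finset.sum_mul]
  have := Finset.sum_range_diag_flip N
    (fun i j => s i * σ^[i + 1] (ℓ j) * coeff e (G ^ p ^ (i + 1 + j)))
  refine Eq.trans (Finset.sum_congr rfl fun k _ => Finset.sum_congr rfl fun i hi => ?_)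
    (this.trans (Finset.sum_congr rfl fun i _ => ?_))
  · rw [Finset.mem_range] at hi
    rw [show i + 1 + (k - i) = k + 1 by omega]
  · refine Finset.sum_subset (fun j hj => ?_) fun j _ hj => ?_
    · rw [Finset.mem_range] at *; omega
    · rw [Finset.mem_range] at hj
      rw [show i + 1 + j = (i + j) + 1 by omega, hz _ (by omega), mul_zero]

/-- The numbers `p ^ k * ℓ k` are integral. -/
lemma exists_pow_mul_eq (ι : A →+* K) (σA : A →+* A) (σ : K →+* K)
    (hσ : ∀ a, σ (ι a) = ι (σA a)) (s : ℕ → A) (ℓ : ℕ → K) (h0 : ℓ 0 = 1)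
    (hℓ : ∀ k, p * ℓ (k + 1) = ∑ i ∈ Finset.range (k + 1), ι (s i) * σ^[i + 1] (ℓ (k - i)))
    (k : ℕ) : ∀ i, ∃ c, (p : K) ^ k * σ^[i] (ℓ k) = ι c := by
  have hσi : ∀ i a, σ^[i] (ι a) = ι (σA^[i] a) := fun i a => by
    induction i with
    | zero => rfl
    | succ i ih => rw [Function.iterate_succ_apply', ih, hσ, Function.iterate_succ_apply']
  have hσp : ∀ i j, σ^[i] ((p : K) ^ j) = (p : K) ^ j := fun i j => by
    rw [iterate_map_pow, Function.iterate_fixed (map_natCast σ p) i]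
  suffices h : ∃ c, (p : K) ^ k * ℓ k = ι c by
    obtain ⟨c, hc⟩ := h
    exact fun i => ⟨σA^[i] c, by rw [← hσi, ← hc, iterate_map_mul, hσp]⟩
  induction k using Nat.strong_induction_on with
  | _ k ih =>
    rcases k with _ | k
    · exact ⟨1, by simp [h0]⟩
    · rw [pow_succ, mul_assoc, hℓ, Finset.mul_sum]
      have : ∀ i ∈ Finset.range (k + 1), ∃ c,
          (p : K) ^ k * (ι (s i) * σ^[i + 1] (ℓ (k - i))) = ι c := fun i hi => by
        rw [Finset.mem_range] at hi
        obtain ⟨c, hc⟩ := ih (k - i) (by omega)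
        refine ⟨p ^ i * s i * σA^[i + 1] c, ?_⟩
        rw [map_mul, map_mul, ← hσi, ← hc, iterate_map_mul, hσp, map_pow, map_natCast]
        nth_rw 1 [show k = i + (k - i) by omega]
        rw [pow_add]
        ring
      choose! c hc using this
      exact ⟨∑ i ∈ Finset.range (k + 1), c i, by rw [map_sum]; exact Finset.sum_congr rfl hc⟩

/-- The functional equation lemma: a power series `F` in two variables with `ℓ(F) = ℓ(X) + ℓ(Y)`
has integral coefficients. -/
theorem integral_of_functional_equation [Fact p.Prime] (ι : A →+* K) (hpK : IsUnit (p : K))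
    (σA : A →+* A) (σ : K →+* K) (hσ : ∀ a, σ (ι a) = ι (σA a))
    (hF : ∀ a, (p : A) ∣ σA a - a ^ p) (s : ℕ → A) (ℓ : ℕ → K) (h0 : ℓ 0 = 1)
    (hℓ : ∀ k, p * ℓ (k + 1) = ∑ i ∈ Finset.range (k + 1), ι (s i) * σ^[i + 1] (ℓ (k - i)))
    (F : MvPowerSeries (Fin 2) K) (hF0 : F.constantCoeff = 0)
    (hFℓ : (pSeriesOf p ℓ).subst F = (pSeriesOf p ℓ).subst (X 0 : MvPowerSeries (Fin 2) K) +
      (pSeriesOf p ℓ).subst (X 1 : MvPowerSeries (Fin 2) K)) :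
    ∃ G : MvPowerSeries (Fin 2) A, G.map ι = F := by
  have hp : 1 < p := (Fact.out : p.Prime).one_lt
  have hp0 : p ≠ 0 := by omega
  set ψ := frobTwist (τ := Fin 2) p hp0 σ with hψ
  suffices h : ∀ m (e : Fin 2 →₀ ℕ), e.degree < m → ∃ c, ι c = coeff e F by
    have h' : ∀ e, ∃ c, ι c = coeff e F := fun e => h (e.degree + 1) e (Nat.lt_succ_self _)
    choose c hc using h'
    obtain ⟨c', hc'⟩ : ∃ c' : MvPowerSeries (Fin 2) A, ∀ d, coeff d c' = c d := ⟨c, fun _ => rfl⟩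
    exact ⟨c', by ext e; rw [MvPowerSeries.coeff_map, hc', hc]⟩
  intro m
  induction m with
  | zero => intro e he; exact absurd he (Nat.not_lt_zero _)
  | succ m ih =>
    intro e he
    rcases Nat.lt_succ_iff_lt_or_eq.mp he with he | he
    · exact ih e he
    rcases Nat.eq_zero_or_pos m with rfl | hm
    · rw [(Finsupp.degree_eq_zero_iff e).mp he]
      exact ⟨0, by rw [map_zero, coeff_zero_eq_constantCoeff_apply, hF0]⟩
    -- an integral approximation to `F` in degrees less than `m`
    obtain ⟨G, hG⟩ : ∃ G : MvPowerSeries (Fin 2) A,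
        ∀ d : Fin 2 →₀ ℕ, d.degree < m → ι (coeff d G) = coeff d F := by
      choose! c hc using ih
      exact ⟨c, fun d hd => hc d hd⟩
    set H := G.map ι with hH
    have hFH : (m : ℕ∞) ≤ (F - H).order := nat_le_order fun d hd => by
      rw [map_sub, hH, MvPowerSeries.coeff_map, hG d hd, sub_self]
    have hH0 : H.constantCoeff = 0 := by
      rw [← hF0, ← coeff_zero_eq_constantCoeff_apply, ← coeff_zero_eq_constantCoeff_apply, hH,
        MvPowerSeries.coeff_map, hG 0 (by simpa using hm)]
    have hψG : ∀ i, ψ^[i] H = ((frobTwist p hp0 σA)^[i] G).map ι := fun i => by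
      induction i with
      | zero => rfl
      | succ i ih =>
        rw [Function.iterate_succ_apply', ih, Function.iterate_succ_apply', hψ, frobTwist_apply,
          frobTwist_apply, ← map_expand]
        ext d
        simp only [MvPowerSeries.coeff_map, hσ]
    have hψFH : ∀ i, ((m + 1 : ℕ) : ℕ∞) ≤ (ψ^[i + 1] F - ψ^[i + 1] H).order := fun i => by
      induction i with
      | zero =>
        rw [zero_add, Function.iterate_one, ← map_sub]
        refine le_trans ?_ (le_order_frobTwist hp0 σ _)
        calc ((m + 1 : ℕ) : ℕ∞) ≤ ((p * m : ℕ) : ℕ∞) := by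
              have : 2 * m ≤ p * m := Nat.mul_le_mul_right m hp
              exact_mod_cast (by omega : m + 1 ≤ p * m)
          _ ≤ _ := by
              rw [nsmul_eq_mul, Nat.cast_mul]
              gcongr
      | succ i ih =>
        rw [Function.iterate_succ_apply', Function.iterate_succ_apply' (n := i + 1), ← map_sub]
        refine ih.trans (le_trans ?_ (le_order_frobTwist hp0 σ _))
        exact le_self_nsmul zero_le hp0
    have hF0i : ∀ i, (F ^ p ^ (i + 1)).constantCoeff = 0 := fun i => by
      rw [map_pow, hF0, zero_pow (pow_pos (by omega) _).ne']
    have hψ0i : ∀ i, (ψ^[i + 1] F).constantCoeff = 0 := fun i =>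
      constantCoeff_frobTwist_iterate hp0 σ hF0 _
    have heN : e.degree < m + 1 := by omega
    -- the functional equation for `F`, `X` and `Y`
    have e1 := coeff_functional_equation hp (fun i => ι (s i)) ℓ σ h0 hℓ hF0 heN
    have e2 := coeff_functional_equation hp (fun i => ι (s i)) ℓ σ h0 hℓ
      (G := (X 0 : MvPowerSeries (Fin 2) K)) (by simp) heN
    have e3 := coeff_functional_equation hp (fun i => ι (s i)) ℓ σ h0 hℓ
      (G := (X 1 : MvPowerSeries (Fin 2) K)) (by simp) heN
    have e4 : ∀ i, coeff e ((pSeriesOf p fun k => σ^[i + 1] (ℓ k)).subst (ψ^[i + 1] F)) =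
        coeff e ((pSeriesOf p fun k => σ^[i + 1] (ℓ k)).subst
          ((X 0 : MvPowerSeries (Fin 2) K) ^ p ^ (i + 1))) +
        coeff e ((pSeriesOf p fun k => σ^[i + 1] (ℓ k)).subst
          ((X 1 : MvPowerSeries (Fin 2) K) ^ p ^ (i + 1))) := fun i => by
      rw [← frobTwist_iterate_X hp0 σ, ← frobTwist_iterate_X hp0 σ,
        ← frobTwist_iterate_subst hp0 σ ℓ hF0, ← frobTwist_iterate_subst hp0 σ ℓ (by simp),
        ← frobTwist_iterate_subst hp0 σ ℓ (by simp), hFℓ, iterate_map_add, map_add]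
    have e5 : (p : K) * coeff e F = p * (coeff e (X 0 : MvPowerSeries (Fin 2) K) +
        coeff e (X 1 : MvPowerSeries (Fin 2) K)) + ∑ i ∈ Finset.range (m + 1), ι (s i) *
        (coeff e ((pSeriesOf p fun k => σ^[i + 1] (ℓ k)).subst (ψ^[i + 1] F)) -
          coeff e ((pSeriesOf p fun k => σ^[i + 1] (ℓ k)).subst (F ^ p ^ (i + 1)))) := by
      simp_rw [mul_sub, Finset.sum_sub_distrib, e4, mul_add, Finset.sum_add_distrib]
      rw [hFℓ, map_add, mul_add, e2, e3] at e1
      linear_combination -e1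
    have e6 : ∀ i, ∃ c, coeff e ((pSeriesOf p fun k => σ^[i + 1] (ℓ k)).subst (ψ^[i + 1] F)) -
          coeff e ((pSeriesOf p fun k => σ^[i + 1] (ℓ k)).subst (F ^ p ^ (i + 1))) =
          p * ι c := fun i => by
      rw [coeff_subst_pSeriesOf hp _ (hψ0i i) heN, coeff_subst_pSeriesOf hp _ (hF0i i) heN,
        ← Finset.sum_sub_distrib]
      have : ∀ k, ∃ c, σ^[i + 1] (ℓ k) * coeff e ((ψ^[i + 1] F) ^ p ^ k) -
          σ^[i + 1] (ℓ k) * coeff e ((F ^ p ^ (i + 1)) ^ p ^ k) = p * ι c := fun k => by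
        have h1 : coeff e ((ψ^[i + 1] F) ^ p ^ k) = coeff e ((ψ^[i + 1] H) ^ p ^ k) :=
          coeff_eq_of_lt_order_sub (order_pow_sub_pow' (hψFH i) _) he
        have h2 : coeff e ((F ^ p ^ (i + 1)) ^ p ^ k) = coeff e (H ^ p ^ (i + 1 + k)) := by
          rw [← pow_mul, ← pow_add]
          refine coeff_eq_of_lt_order_sub (order_pow_sub_pow hF0 hH0 hFH ?_) he
          exact hp.trans_le (Nat.le_self_pow (by omega) p)
        obtain ⟨D, hD⟩ := frobTwist_pow_sub_pow hp0 σA hF G (i + 1) k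
        obtain ⟨c, hc⟩ := exists_pow_mul_eq ι σA σ hσ s ℓ h0 hℓ k (i + 1)
        have h3 := congrArg (fun f => coeff e (MvPowerSeries.map ι f)) hD
        have h4 : ((p : MvPowerSeries (Fin 2) K)) ^ (k + 1) = C ((p : K) ^ (k + 1)) := by simp
        simp only [map_sub, map_pow, map_mul, map_natCast, ← hψG, ← hH] at h3
        rw [h4, coeff_C_mul, MvPowerSeries.coeff_map] at h3
        refine ⟨c * coeff e D, ?_⟩
        rw [h1, h2, ← mul_sub, h3, map_mul, ← hc]
        ring
      choose c hc using this
      exact ⟨∑ k ∈ Finset.range (m + 1), c k, by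
        rw [map_sum, Finset.mul_sum]; exact Finset.sum_congr rfl fun k _ => hc k⟩
    choose c hc using e6
    have hX : ∀ j : Fin 2, coeff e (X j : MvPowerSeries (Fin 2) K) =
        ι (coeff e (X j : MvPowerSeries (Fin 2) A)) := fun j => by
      rw [← MvPowerSeries.coeff_map, MvPowerSeries.map_X]
    refine ⟨coeff e (X 0 : MvPowerSeries (Fin 2) A) + coeff e (X 1 : MvPowerSeries (Fin 2) A) +
      ∑ i ∈ Finset.range (m + 1), s i * c i, hpK.mul_left_cancel ?_⟩
    rw [e5, map_add, map_add, map_sum, hX, hX, mul_add, Finset.mul_sum]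
    congr 1
    refine Finset.sum_congr rfl fun i _ => ?_
    rw [hc, map_mul]
    ring

end FunctionalEquation

section Araki

variable {A K : Type*} [CommRing A] [CommRing K] [IsDomain K] {p : ℕ}

/-- Araki's recursion `p ℓₖ = ∑ ℓᵢ v_{k-i}^{pⁱ}`, with `v₀ = p`, implies a functional equation. -/
lemma exists_functional_equation (hp : 1 < p) (ι : A →+* K) (hpK : (p : K) ≠ 0)
    (hu : ∀ j, j ≠ 0 → IsUnit (1 - (p : A) ^ j)) (σA : A →+* A)
    (σ : K →+* K) (hσ : ∀ a, σ (ι a) = ι (σA a)) (v : ℕ → A) (hv0 : v 0 = p)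
    (hv : ∀ i, i ≠ 0 → σA (v i) = v i ^ p) (ℓ : ℕ → K) (h0 : ℓ 0 = 1)
    (hℓ : ∀ k, p * ℓ k = ∑ i ∈ Finset.range (k + 1), ℓ i * ι (v (k - i)) ^ p ^ i) :
    ∃ s : ℕ → A, ∀ k, p * ℓ (k + 1) =
      ∑ i ∈ Finset.range (k + 1), ι (s i) * σ^[i + 1] (ℓ (k - i)) := by
  have hσi : ∀ i a, σ^[i] (ι a) = ι (σA^[i] a) := fun i a => by
    induction i with
    | zero => rfl
    | succ i ih => rw [Function.iterate_succ_apply', ih, hσ, Function.iterate_succ_apply']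
  have hσp : ∀ i, σ^[i] (p : K) = p := fun i => Function.iterate_fixed (map_natCast σ p) i
  have hσv : ∀ i j, j ≠ 0 → σ^[i] (ι (v j)) = ι (v j) ^ p ^ i := fun i j hj => by
    induction i with
    | zero => simp
    | succ i ih => rw [Function.iterate_succ_apply', ih, map_pow, hσ, hv j hj, map_pow, ← pow_mul,
        pow_succ']
  have hpow : ∀ k, k < p ^ k := fun k => Nat.lt_pow_self hp
  have hσsum : ∀ i n (f : ℕ → K), σ^[i] (∑ j ∈ Finset.range n, f j) =
      ∑ j ∈ Finset.range n, σ^[i] (f j) := fun i n f => by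
    induction i with
    | zero => rfl
    | succ i ih => simp only [Function.iterate_succ_apply', ih, map_sum]
  -- the solved form of the recursion
  have hℓ' : ∀ k, p * ℓ k - (p : K) ^ p ^ k * ℓ k =
      ∑ i ∈ Finset.range k, ℓ i * ι (v (k - i)) ^ p ^ i := fun k => by
    rw [hℓ, Finset.sum_range_succ, Nat.sub_self, hv0, map_natCast]
    ring
  have hint : ∀ k, ∃ c, ι c = (p : K) ^ k * ℓ k := fun k => by
    induction k using Nat.strong_induction_on with
    | _ k ih =>
      rcases k with _ | k
      · exact ⟨1, by simp [h0]⟩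
      choose! c hc using ih
      have hk := hpow (k + 1)
      obtain ⟨w, hw⟩ := (hu (p ^ (k + 1) - 1) (by omega)).exists_right_inv
      refine ⟨w * ∑ i ∈ Finset.range (k + 1), p ^ (k - i) * c i * v (k + 1 - i) ^ p ^ i, ?_⟩
      have h1 : ι (∑ i ∈ Finset.range (k + 1), p ^ (k - i) * c i * v (k + 1 - i) ^ p ^ i) =
          (p : K) ^ k * (p * ℓ (k + 1) - (p : K) ^ p ^ (k + 1) * ℓ (k + 1)) := by
        rw [hℓ', map_sum, Finset.mul_sum]
        refine Finset.sum_congr rfl fun i hi => ?_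
        rw [Finset.mem_range] at hi
        rw [map_mul, map_mul, map_pow, map_pow, map_natCast, hc i hi, ← mul_assoc, ← mul_assoc,
          ← pow_add, Nat.sub_add_cancel (by omega)]
      have h2 := congrArg ι hw
      rw [map_mul, map_sub, map_one, map_pow, map_natCast] at h2
      rw [map_mul, h1, show p ^ (k + 1) = (p ^ (k + 1) - 1) + 1 by omega, pow_succ]
      linear_combination (p : K) ^ (k + 1) * ℓ (k + 1) * h2
  obtain ⟨e, he⟩ : ∃ e : ℕ → A, ∀ k, p * ι (e k) = (p : K) ^ p ^ k * ℓ k := by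
    choose c hc using hint
    refine ⟨fun k => p ^ (p ^ k - 1 - k) * c k, fun k => ?_⟩
    have hk := hpow k
    rw [map_mul, hc, map_pow, map_natCast, ← mul_assoc, ← mul_assoc, ← pow_succ', ← pow_add]
    congr 2
    omega
  have he0 : ι (e 0) = 1 := by
    apply mul_left_cancel₀ hpK
    rw [he, h0, pow_zero, pow_one]
  let V : ℕ → A := fun k => if k = 0 then p else - v k
  obtain ⟨η, hη⟩ : ∃ η : ℕ → A, ∀ k, ι (V k) =
      ∑ i ∈ Finset.range (k + 1), ι (η i) * σ^[i] (ι (e (k - i))) := by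
    let η : ℕ → A := fun k => Nat.strongRec
      (fun k ih => V k - ∑ i : Fin k, ih i.1 i.2 * σA^[i] (e (k - i))) k
    have h : ∀ k, η k = V k - ∑ i ∈ Finset.range k, η i * σA^[i] (e (k - i)) := fun k => by
      rw [← Fin.sum_univ_eq_sum_range (fun i => η i * σA^[i] (e (k - i)))]
      exact Nat.strongRec.eq_1 _ _
    refine ⟨η, fun k => ?_⟩
    rw [Finset.sum_range_succ, Nat.sub_self, he0, iterate_map_one, mul_one, h k, map_sub, map_sum]
    simp_rw [map_mul, hσi]
    ring
  have hσV : ∀ i j, j ≠ 0 → σ^[i] (ι (V j)) = - ι (v j) ^ p ^ i := fun i j hj => by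
    simp only [V, if_neg hj]
    rw [map_neg, iterate_map_neg, hσv i j hj]
  have hV0 : ι (V 0) = p := by simp [V]
  have hℓV : ∀ k, ∑ j ∈ Finset.range (k + 1), ℓ j * σ^[j] (ι (V (k - j))) =
      p * ι (e k) := fun k => by
    rw [he, Finset.sum_range_succ, Nat.sub_self, hV0, hσp]
    have : ∑ j ∈ Finset.range k, ℓ j * σ^[j] (ι (V (k - j))) =
        - ∑ i ∈ Finset.range k, ℓ i * ι (v (k - i)) ^ p ^ i := by
      rw [← Finset.sum_neg_distrib]
      refine Finset.sum_congr rfl fun j hj => ?_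
      rw [Finset.mem_range] at hj
      rw [hσV _ _ (by omega), mul_neg]
    rw [this, ← hℓ']
    ring
  let x : ℕ → K := fun k => ∑ i ∈ Finset.range (k + 1), ι (η i) * σ^[i] (ℓ (k - i))
  have hxV : ∀ k, ∑ i ∈ Finset.range (k + 1), x i * σ^[i] (ι (V (k - i))) = p * ι (V k) :=
    fun k => by
    have := Finset.sum_range_diag_flip (k + 1)
      (fun a b => ι (η a) * σ^[a] (ℓ b) * σ^[a + b] (ι (V (k - (a + b)))))
    refine (Finset.sum_congr rfl fun i _ => ?_).trans (this.trans ((Finset.sum_congr rfl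
      (g := fun a => ι (η a) * σ^[a] (p * ι (e (k - a)))) fun a ha => ?_).trans ?_))
    · simp only [x]
      rw [Finset.sum_mul]
      refine Finset.sum_congr rfl fun a ha => ?_
      rw [Finset.mem_range] at ha
      rw [show a + (i - a) = i by omega]
    · rw [Finset.mem_range] at ha
      rw [show k + 1 - a = (k - a) + 1 by omega, ← hℓV, hσsum, Finset.mul_sum]
      refine Finset.sum_congr rfl fun b _ => ?_
      rw [iterate_map_mul, Function.iterate_add_apply, mul_assoc, Nat.sub_add_eq]
    · rw [hη, Finset.mul_sum]
      refine Finset.sum_congr rfl fun a _ => ?_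
      rw [iterate_map_mul, hσp]
      ring
  have hx0 : x 0 = p := by
    have := hη 0
    simp only [zero_add, Finset.sum_range_one, Nat.sub_self, he0, iterate_map_one, mul_one] at this
    simp [x, h0, ← this, hV0]
  have hx : ∀ k, x (k + 1) = 0 := fun k => by
    induction k using Nat.strong_induction_on with
    | _ k ih =>
      have h := hxV (k + 1)
      rw [Finset.sum_range_succ, Finset.sum_range_succ', Nat.sub_self, hV0, hσp, hx0,
        Finset.sum_eq_zero fun i hi => by
          rw [ih i (Finset.mem_range.mp hi), zero_mul]] at h
      simp only [Nat.sub_zero, Function.iterate_zero_apply, zero_add] at h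
      have h' : x (k + 1) * (p : K) = 0 := by linear_combination h
      exact (mul_eq_zero.mp h').resolve_right hpK
  refine ⟨fun i => - η (i + 1), fun k => ?_⟩
  have h := hx k
  have hη0 : ι (η 0) = p := by simpa [x, h0] using hx0
  simp only [x] at h
  rw [Finset.sum_range_succ', hη0] at h
  simp only [Nat.add_sub_add_right, Function.iterate_zero_apply, Nat.sub_zero] at h
  simp_rw [map_neg, neg_mul, Finset.sum_neg_distrib]
  linear_combination h

end Araki

section Log

variable {R : Type*} [CommRing R]

lemma subst_log_injective {l : PowerSeries R} (h0 : l.constantCoeff = 0) (h1 : l.coeff 1 = 1)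
    {τ : Type*} {G H : MvPowerSeries τ R} (hG : G.constantCoeff = 0) (hH : H.constantCoeff = 0)
    (h : l.subst G = l.subst H) : G = H := by
  have : Invertible (l.coeff 1) := h1 ▸ invertibleOne
  have key : ∀ {G : MvPowerSeries τ R}, G.constantCoeff = 0 →
      l.substInv.subst (l.subst G) = G := fun {G} hG => by
    have hG' := PowerSeries.HasSubst.of_constantCoeff_zero hG
    rw [← PowerSeries.subst_comp_subst_apply (PowerSeries.HasSubst.of_constantCoeff_zero' h0) hG',
      PowerSeries.subst_substInv_left l h0, PowerSeries.subst_X hG']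
  rw [← key hG, h, key hH]

lemma exists_subst_log_eq {l : PowerSeries R} (h0 : l.constantCoeff = 0) (h1 : l.coeff 1 = 1)
    {τ : Type*} {L : MvPowerSeries τ R} (hL : L.constantCoeff = 0) :
    ∃ G : MvPowerSeries τ R, G.constantCoeff = 0 ∧ l.subst G = L := by
  have : Invertible (l.coeff 1) := h1 ▸ invertibleOne
  have hL' := PowerSeries.HasSubst.of_constantCoeff_zero hL
  refine ⟨l.substInv.subst L, PowerSeries.constantCoeff_subst_eq_zero hL _ (by simp), ?_⟩
  rw [← PowerSeries.subst_comp_subst_apply (PowerSeries.HasSubst.substInv l) hL',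
    PowerSeries.subst_substInv_right l h0, PowerSeries.subst_X hL']

/-- A power series with integral coefficients that becomes `ℓ⁻¹(ℓ(X) + ℓ(Y))` is a formal group
law. -/
lemma exists_formalGroup {A K : Type*} [CommRing A] [CommRing K] {ι : A →+* K}
    (hι : Function.Injective ι) {p : ℕ} (hp : 1 < p) {ℓ : ℕ → K} (h0 : ℓ 0 = 1)
    {F : MvPowerSeries (Fin 2) A} (hF0 : F.constantCoeff = 0)
    (hF : (pSeriesOf p ℓ).subst (F.map ι) =
      (pSeriesOf p ℓ).subst (X 0 : MvPowerSeries (Fin 2) K) +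
        (pSeriesOf p ℓ).subst (X 1 : MvPowerSeries (Fin 2) K)) :
    ∃ G : FormalGroup A, G.toPowerSeries = F := by
  have hl0 := constantCoeff_pSeriesOf hp ℓ
  have hl1 : (pSeriesOf p ℓ).coeff 1 = 1 := by rw [coeff_one_pSeriesOf hp, h0]
  have hFK : (F.map ι).constantCoeff = 0 := by rw [constantCoeff_map, hF0, map_zero]
  have hinj : ∀ {τ : Type}, Function.Injective (MvPowerSeries.map (σ := τ) ι) :=
    fun {τ} G H h => by
      ext d
      apply hι
      rw [← MvPowerSeries.coeff_map, h, MvPowerSeries.coeff_map]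
  have hlin : ∀ {G : MvPowerSeries (Fin 2) K} (_ : G.constantCoeff = 0) (j : Fin 2),
      coeff (Finsupp.single j 1) ((pSeriesOf p ℓ).subst G) = coeff (Finsupp.single j 1) G :=
    fun {G} hG j => by
      rw [coeff_subst_pSeriesOf hp ℓ hG (N := 2) (by simp), Finset.sum_range_succ,
        Finset.sum_range_one, h0, pow_one, coeff_pow_eq_zero hG (r := p) (by simpa), pow_zero,
        pow_one]
      simp
  have hcoef : ∀ j : Fin 2, coeff (Finsupp.single j 1) F = 1 := fun j => by
    apply hι
    have := congrArg (coeff (Finsupp.single j 1)) hF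
    rw [map_add, hlin hFK, hlin (by simp), hlin (by simp), MvPowerSeries.coeff_map] at this
    rw [this, map_one]
    fin_cases j <;> simp [coeff_index_single_X]
  have hadd : ∀ {a b : MvPowerSeries (Fin 3) K}, a.constantCoeff = 0 → b.constantCoeff = 0 →
      ((F.map ι).subst ![a, b]).constantCoeff = 0 ∧
      (pSeriesOf p ℓ).subst ((F.map ι).subst ![a, b]) =
        (pSeriesOf p ℓ).subst a + (pSeriesOf p ℓ).subst b := fun {a b} ha hb => by
    have hab : HasSubst ![a, b] := hasSubst_of_constantCoeff_zero fun s => by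
      fin_cases s <;> simpa
    refine ⟨constantCoeff_subst_eq_zero hab (fun s => by fin_cases s <;> simpa) hFK, ?_⟩
    have h := congrArg (MvPowerSeries.subst ![a, b]) hF
    rw [subst_add hab] at h
    have hc : ∀ {G : MvPowerSeries (Fin 2) K}, G.constantCoeff = 0 →
        MvPowerSeries.subst ![a, b] ((pSeriesOf p ℓ).subst G) =
          (pSeriesOf p ℓ).subst (G.subst ![a, b]) := fun {G} hG => by
      rw [PowerSeries.subst, PowerSeries.subst, subst_comp_subst_apply
        (PowerSeries.HasSubst.of_constantCoeff_zero hG).const hab]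
    rw [hc hFK, hc (by simp), hc (by simp), subst_X hab, subst_X hab] at h
    simpa using h
  have hX : ∀ j : Fin 3, (X j : MvPowerSeries (Fin 3) K).constantCoeff = 0 := fun j => by simp
  have hXA : ∀ j : Fin 3, (X j : MvPowerSeries (Fin 3) A).constantCoeff = 0 := fun j => by simp
  have hmap : ∀ {a b : MvPowerSeries (Fin 3) A}, a.constantCoeff = 0 → b.constantCoeff = 0 →
      (F.subst ![a, b]).constantCoeff = 0 ∧
      (F.subst ![a, b]).map ι = (F.map ι).subst ![a.map ι, b.map ι] := fun {a b} ha hb => by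
    have hab : HasSubst ![a, b] := hasSubst_of_constantCoeff_zero fun s => by
      fin_cases s <;> simpa
    refine ⟨constantCoeff_subst_eq_zero hab (fun s => by fin_cases s <;> simpa) hF0, ?_⟩
    rw [map_subst hab]
    congr 1
    ext1 s
    fin_cases s <;> rfl
  refine ⟨⟨F, hF0, hcoef 0, hcoef 1, ?_⟩, rfl⟩
  apply hinj
  rw [(hmap (hmap (hXA 0) (hXA 1)).1 (hXA 2)).2, (hmap (hXA 0) (hXA 1)).2,
    (hmap (hXA 0) (hmap (hXA 1) (hXA 2)).1).2, (hmap (hXA 1) (hXA 2)).2]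
  simp only [map_X]
  have h01 := hadd (hX 0) (hX 1)
  have h12 := hadd (hX 1) (hX 2)
  have h1 := hadd h01.1 (hX 2)
  have h2 := hadd (hX 0) h12.1
  refine subst_log_injective hl0 hl1 h1.1 h2.1 ?_
  rw [h1.2, h2.2, h01.2, h12.2, add_assoc]

end Log

section Universal

variable (p : ℕ) [Fact p.Prime]

/-- Araki's generators `v₀ = p, v₁, v₂, …` of `ℤ_p[v₁, v₂, …]`; the variable with index `i` is
`v_{i+1}`. -/
noncomputable def arakiGen : ℕ → MvPolynomial ℕ ℤ_[p]
  | 0 => (p : MvPolynomial ℕ ℤ_[p])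
  | i + 1 => MvPolynomial.X i

/-- The inclusion of `ℤ_p[v₁, v₂, …]` in `ℚ_p[v₁, v₂, …]`. -/
noncomputable def toRational : MvPolynomial ℕ ℤ_[p] →+* MvPolynomial ℕ ℚ_[p] :=
  MvPolynomial.map (algebraMap ℤ_[p] ℚ_[p])

/-- The coefficients `ℓₖ` of the universal `p`-typical logarithm `∑ₖ ℓₖ x^(p^k)`: `ℓ₀ = 1` and
`(p - p^(p^k)) ℓₖ = ∑_{i<k} ℓᵢ v_{k-i}^(p^i)`, which is to say `p ℓₖ = ∑_{i≤k} ℓᵢ v_{k-i}^(p^i)`. -/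
noncomputable def arakiLogCoeff : ℕ → MvPolynomial ℕ ℚ_[p]
  | 0 => 1
  | k + 1 => MvPolynomial.C (((p : ℚ_[p]) - (p : ℚ_[p]) ^ p ^ (k + 1))⁻¹) *
      ∑ i : Fin (k + 1), arakiLogCoeff i.1 * toRational p (arakiGen p (k + 1 - i.1)) ^ p ^ i.1

/-- The universal `p`-typical logarithm `∑ₖ ℓₖ x^(p^k)`. -/
noncomputable def arakiLog : PowerSeries (MvPolynomial ℕ ℚ_[p]) :=
  pSeriesOf p (arakiLogCoeff p)

lemma toRational_injective : Function.Injective (toRational p) :=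
  MvPolynomial.map_injective _ (FaithfulSMul.algebraMap_injective _ _)

/-- Araki's formula. -/
theorem arakiLogCoeff_eq (k : ℕ) : p * arakiLogCoeff p k =
    ∑ i ∈ Finset.range (k + 1), arakiLogCoeff p i * toRational p (arakiGen p (k - i)) ^ p ^ i := by
  have hp : 1 < p := (Fact.out : p.Prime).one_lt
  rcases k with _ | k
  · simp [arakiLogCoeff, arakiGen]
  rw [Finset.sum_range_succ, Nat.sub_self, arakiGen, map_natCast]
  have h := arakiLogCoeff.eq_2 p k
  rw [Fin.sum_univ_eq_sum_range (fun i => arakiLogCoeff p i *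
    toRational p (arakiGen p (k + 1 - i)) ^ p ^ i)] at h
  set S := ∑ i ∈ Finset.range (k + 1), arakiLogCoeff p i *
    toRational p (arakiGen p (k + 1 - i)) ^ p ^ i
  have hne : (p : ℚ_[p]) - (p : ℚ_[p]) ^ p ^ (k + 1) ≠ 0 := by
    rw [sub_ne_zero]
    have : p ^ 1 ≠ p ^ p ^ (k + 1) := fun h => by
      have h1 := Nat.pow_right_injective hp h
      have h2 := Nat.lt_pow_self hp (n := k + 1)
      omega
    rw [pow_one] at this
    exact_mod_cast this
  have h2 : MvPolynomial.C ((p : ℚ_[p]) - (p : ℚ_[p]) ^ p ^ (k + 1)) * arakiLogCoeff p (k + 1) =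
      S := by
    rw [h, ← mul_assoc, ← map_mul, mul_inv_cancel₀ hne, map_one, one_mul]
  rw [map_sub, map_pow, map_natCast] at h2
  rw [← h2]
  ring

lemma natCast_dvd_expand_sub_pow (a : MvPolynomial ℕ ℤ_[p]) :
    (p : MvPolynomial ℕ ℤ_[p]) ∣ MvPolynomial.expand p a - a ^ p := by
  have h : MvPolynomial.map PadicInt.toZMod (MvPolynomial.expand p a - a ^ p) = 0 := by
    rw [map_sub, map_pow, MvPolynomial.map_expand, MvPolynomial.expand_zmod, sub_self]
  rw [show (p : MvPolynomial ℕ ℤ_[p]) = MvPolynomial.C (p : ℤ_[p]) by simp,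
    MvPolynomial.C_dvd_iff_dvd_coeff]
  intro d
  have h1 := congrArg (MvPolynomial.coeff d) h
  rw [MvPolynomial.coeff_map, MvPolynomial.coeff_zero, ← RingHom.mem_ker, PadicInt.ker_toZMod,
    PadicInt.maximalIdeal_eq_span_p, Ideal.mem_span_singleton] at h1
  exact h1

/-- The logarithm is that of a formal group law with integral coefficients. -/
theorem exists_arakiLaw : ∃ F : FormalGroup (MvPolynomial ℕ ℤ_[p]),
    (arakiLog p).subst (F.map (toRational p)).toPowerSeries =
      (arakiLog p).subst (X 0 : MvPowerSeries (Fin 2) (MvPolynomial ℕ ℚ_[p])) +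
        (arakiLog p).subst (X 1 : MvPowerSeries (Fin 2) (MvPolynomial ℕ ℚ_[p])) := by
  have hp : 1 < p := (Fact.out : p.Prime).one_lt
  have h0 : arakiLogCoeff p 0 = 1 := by rw [arakiLogCoeff]
  have hl0 := constantCoeff_pSeriesOf hp (arakiLogCoeff p)
  have hl1 : (pSeriesOf p (arakiLogCoeff p)).coeff 1 = 1 := by rw [coeff_one_pSeriesOf hp, h0]
  have hpQ : (p : ℚ_[p]) ≠ 0 := by exact_mod_cast (by omega : p ≠ 0)
  have hpu : IsUnit (p : MvPolynomial ℕ ℚ_[p]) := by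
    rw [show (p : MvPolynomial ℕ ℚ_[p]) = MvPolynomial.C (p : ℚ_[p]) by simp]
    exact (IsUnit.mk0 _ hpQ).map _
  have hu : ∀ j, j ≠ 0 → IsUnit (1 - (p : MvPolynomial ℕ ℤ_[p]) ^ j) := fun j hj => by
    rw [show 1 - (p : MvPolynomial ℕ ℤ_[p]) ^ j = MvPolynomial.C (1 - (p : ℤ_[p]) ^ j) by simp]
    refine IsUnit.map _ (IsLocalRing.isUnit_one_sub_self_of_mem_nonunits _ ?_)
    rw [← IsLocalRing.mem_maximalIdeal, PadicInt.maximalIdeal_eq_span_p]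
    exact Ideal.pow_mem_of_mem _ (Ideal.mem_span_singleton_self _) j (Nat.pos_of_ne_zero hj)
  let σA : MvPolynomial ℕ ℤ_[p] →+* MvPolynomial ℕ ℤ_[p] := (MvPolynomial.expand p).toRingHom
  let σ : MvPolynomial ℕ ℚ_[p] →+* MvPolynomial ℕ ℚ_[p] := (MvPolynomial.expand p).toRingHom
  have hσ : ∀ a, σ (toRational p a) = toRational p (σA a) := fun a =>
    (MvPolynomial.map_expand _ _ a).symm
  have hv : ∀ i, i ≠ 0 → σA (arakiGen p i) = arakiGen p i ^ p := fun i hi => by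
    obtain ⟨i, rfl⟩ := Nat.exists_eq_succ_of_ne_zero hi
    exact MvPolynomial.expand_X p i
  obtain ⟨s, hs⟩ := exists_functional_equation hp (toRational p) hpu.ne_zero hu σA σ hσ
    (arakiGen p) rfl hv (arakiLogCoeff p) h0 (arakiLogCoeff_eq p)
  obtain ⟨F, hF0, hF⟩ := exists_subst_log_eq hl0 hl1
    (L := (pSeriesOf p (arakiLogCoeff p)).subst (X 0 : MvPowerSeries (Fin 2) _) +
      (pSeriesOf p (arakiLogCoeff p)).subst (X 1 : MvPowerSeries (Fin 2) _)) (by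
        rw [map_add, PowerSeries.constantCoeff_subst_eq_zero (by simp) _ hl0,
          PowerSeries.constantCoeff_subst_eq_zero (by simp) _ hl0, add_zero])
  obtain ⟨G, rfl⟩ := integral_of_functional_equation (toRational p) hpu σA σ hσ
    (natCast_dvd_expand_sub_pow p) s (arakiLogCoeff p) h0 hs F hF0 hF
  obtain ⟨H, rfl⟩ := exists_formalGroup (toRational_injective p) hp h0
    (toRational_injective p (by rw [← MvPowerSeries.constantCoeff_map, hF0, map_zero])) hF
  exact ⟨H, hF⟩

/-- The universal `p`-typical formal group law over `ℤ_p[v₁, v₂, …]`, with Araki's generators. It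
is the only formal group law with the logarithm `arakiLog p`. -/
noncomputable def arakiLaw : FormalGroup (MvPolynomial ℕ ℤ_[p]) := (exists_arakiLaw p).choose

theorem arakiLog_subst_arakiLaw :
    (arakiLog p).subst ((arakiLaw p).map (toRational p)).toPowerSeries =
      (arakiLog p).subst (X 0 : MvPowerSeries (Fin 2) (MvPolynomial ℕ ℚ_[p])) +
        (arakiLog p).subst (X 1 : MvPowerSeries (Fin 2) (MvPolynomial ℕ ℚ_[p])) :=
  (exists_arakiLaw p).choose_spec

end Universal

section Laws

variable (p : ℕ) [Fact p.Prime]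

/-- The specialisation of the universal `p`-typical formal group law to an `𝔽_p`-algebra, along
`v_{i+1} ↦ c i`. -/
noncomputable def arakiLawMod {R : Type*} [CommRing R] [Algebra (ZMod p) R] (c : ℕ → R) :
    FormalGroup R :=
  (arakiLaw p).map (MvPolynomial.eval₂Hom ((algebraMap (ZMod p) R).comp PadicInt.toZMod) c)

/-- The formal group law `F₀` over `𝔽_p[y⁻¹]`, where the polynomial variable stands for `y⁻¹`:
the specialisation `v_{n-1} ↦ 1`, `v_n ↦ -y^((1-p)q)` with `q = p^(n-1)`, and `v_i ↦ 0` for the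
other `i`. -/
noncomputable def reducedLaw (n : ℕ) : FormalGroup (Polynomial (ZMod p)) :=
  arakiLawMod p fun i =>
    if i + 1 = n - 1 then 1
    else if i + 1 = n then -Polynomial.X ^ ((p - 1) * p ^ (n - 1))
    else 0

/-- The Honda formal group law of height `h` over `𝔽_p`: the specialisation `v_h ↦ 1` and
`v_i ↦ 0` for the other `i`. -/
noncomputable def hondaLaw (h : ℕ) : FormalGroup (ZMod p) :=
  arakiLawMod p fun i => if i + 1 = h then 1 else 0

end Laws

section FormalGroupLaws

variable {R : Type*} [CommRing R]

/-- The `m`-series `[m]_F(t)`: `[0]_F(t) = 0` and `[m+1]_F(t) = F([m]_F(t), t)`. -/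
noncomputable def nSeries (F : FormalGroup R) : ℕ → PowerSeries R
  | 0 => 0
  | m + 1 => F.toPowerSeries.subst ![nSeries F m, PowerSeries.X]

/-- `φ` is a homomorphism `F → G` of formal group laws: `φ(0) = 0` and
`φ(F(X, Y)) = G(φ(X), φ(Y))`. -/
def IsHom (F G : FormalGroup R) (φ : PowerSeries R) : Prop :=
  φ.constantCoeff = 0 ∧
    φ.subst F.toPowerSeries = G.toPowerSeries.subst
      ![φ.subst (X 0 : MvPowerSeries (Fin 2) R), φ.subst (X 1 : MvPowerSeries (Fin 2) R)]

/-- `φ` is an isomorphism `F → G` of formal group laws: a homomorphism that has an inverse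
homomorphism under composition. -/
def IsIso (F G : FormalGroup R) (φ : PowerSeries R) : Prop :=
  IsHom F G φ ∧ ∃ ψ, IsHom G F ψ ∧ ψ.subst φ = (PowerSeries.X : PowerSeries R) ∧
    φ.subst ψ = (PowerSeries.X : PowerSeries R)

/-- An isomorphism is strict if it is `t` modulo `t²`. -/
def IsStrictIso (F G : FormalGroup R) (φ : PowerSeries R) : Prop :=
  IsIso F G φ ∧ φ.coeff 1 = 1

end FormalGroupLaws

section Expansions

variable (k : Type*) [Field k]

lemma transcendental_single_one :
    Transcendental k (HahnSeries.single (1 : ℤ) (1 : k) : LaurentSeries k) := by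
  rw [transcendental_iff_injective]
  have h : (Polynomial.aeval (HahnSeries.single (1 : ℤ) (1 : k) : LaurentSeries k)).toRingHom =
      (HahnSeries.ofPowerSeries ℤ k).comp (Polynomial.coeToPowerSeries.ringHom (R := k)) := by
    refine Polynomial.ringHom_ext (fun c => ?_) ?_
    · rw [← Polynomial.algebraMap_eq]
      simp only [AlgHom.toRingHom_eq_coe, RingHom.coe_coe, AlgHom.commutes]
      change HahnSeries.ofPowerSeries ℤ k (PowerSeries.C c) = _
      simp
    · simp
  have h' : Function.Injective ((HahnSeries.ofPowerSeries ℤ k).comp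
      (Polynomial.coeToPowerSeries.ringHom (R := k))) :=
    HahnSeries.ofPowerSeries_injective.comp (Polynomial.coe_injective k)
  rw [← h] at h'
  exact h'

lemma transcendental_single_neg_one :
    Transcendental k (HahnSeries.single (-1 : ℤ) (1 : k) : LaurentSeries k) := by
  have h : (HahnSeries.single (-1 : ℤ) (1 : k) : LaurentSeries k) =
      (HahnSeries.single (1 : ℤ) (1 : k) : LaurentSeries k)⁻¹ := by
    rw [HahnSeries.inv_single, inv_one]
  rw [h, Transcendental, IsAlgebraic.inv_iff]
  exact transcendental_single_one k

variable {k} in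
/-- The embedding of `k(y)` in `k((x))` that sends `y` to the transcendental element `a`. -/
noncomputable def expandAlong (a : LaurentSeries k) (ha : Transcendental k a) :
    RatFunc k →+* LaurentSeries k :=
  RatFunc.liftRingHom (Polynomial.aeval a).toRingHom
    (nonZeroDivisors_le_comap_nonZeroDivisors_of_injective _ (transcendental_iff_injective.mp ha))

variable {k} in
lemma expandAlong_X (a : LaurentSeries k) (ha : Transcendental k a) :
    expandAlong a ha RatFunc.X = a := by
  rw [expandAlong, ← RatFunc.algebraMap_X, RatFunc.liftRingHom_algebraMap]
  exact Polynomial.aeval_X _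

/-- Expansion at `y = ∞`: the embedding of `k(y)` in the field `k((y⁻¹))` of Laurent series in the
variable `y⁻¹` that sends `y` to the inverse of this variable. -/
noncomputable def expandAtInfinity : RatFunc k →+* LaurentSeries k :=
  expandAlong (HahnSeries.single (-1) 1) (transcendental_single_neg_one k)

/-- Expansion at `y = 0`: the embedding of `k(y)` in the field `k((y))` that sends `y` to `y`. -/
noncomputable def expandAtZero : RatFunc k →+* LaurentSeries k :=
  expandAlong (HahnSeries.single 1 1) (transcendental_single_one k)

/-- The inclusion of `k[y⁻¹]`, with the polynomial variable as `y⁻¹`, in `k(y)`. -/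
noncomputable def invVarToRatFunc : Polynomial k →+* RatFunc k :=
  (Polynomial.aeval (RatFunc.X : RatFunc k)⁻¹).toRingHom

end Expansions

section BaseChange

variable (p : ℕ) [Fact p.Prime]

/-- The separable closure of `𝔽_p(y)`. -/
abbrev RatSep : Type := SeparableClosure (RatFunc (ZMod p))

/-- The separable closure of a field `𝔽_p((x))` of Laurent series. -/
abbrev LaurentSep : Type := SeparableClosure (LaurentSeries (ZMod p))

/-- `ι` extends the embedding `e` of `𝔽_p(y)` in a field of Laurent series to the separable
closures. -/
def Extends (ι : RatSep p →+* LaurentSep p) (e : RatFunc (ZMod p) →+* LaurentSeries (ZMod p)) :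
    Prop :=
  ι.comp (algebraMap (RatFunc (ZMod p)) (RatSep p)) =
    (algebraMap (LaurentSeries (ZMod p)) (LaurentSep p)).comp e

/-- `F₀` over the separable closure of `𝔽_p(y)`. -/
noncomputable def reducedLawRatSep (n : ℕ) : FormalGroup (RatSep p) :=
  (reducedLaw p n).map ((algebraMap (RatFunc (ZMod p)) (RatSep p)).comp (invVarToRatFunc (ZMod p)))

/-- `F₀` over `𝔽_p[[y⁻¹]]`, where the power series variable stands for `y⁻¹`. -/
noncomputable def reducedLawPowerSeries (n : ℕ) : FormalGroup (PowerSeries (ZMod p)) :=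
  (reducedLaw p n).map Polynomial.coeToPowerSeries.ringHom

/-- `F₀` over the separable closure of `𝔽_p((y))`. -/
noncomputable def reducedLawLaurentSep (n : ℕ) : FormalGroup (LaurentSep p) :=
  (reducedLaw p n).map ((algebraMap (LaurentSeries (ZMod p)) (LaurentSep p)).comp
    ((expandAtZero (ZMod p)).comp (invVarToRatFunc (ZMod p))))

/-- The Honda formal group law of height `h` over an `𝔽_p`-algebra. -/
noncomputable def hondaLawOver (R : Type*) [CommRing R] [Algebra (ZMod p) R] (h : ℕ) :
    FormalGroup R :=
  (hondaLaw p h).map (algebraMap (ZMod p) R)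

variable {p}

/-- `φ` is the image of `Φ` under the coefficientwise action of `ι`, with coefficients in
`𝔽_p[[y⁻¹]]`, and `φ(t) ≡ t` modulo `y⁻¹`. -/
def IsUnipotentExpansion (ι : RatSep p →+* LaurentSep p) (Φ : PowerSeries (RatSep p))
    (φ : PowerSeries (PowerSeries (ZMod p))) : Prop :=
  Φ.map ι = φ.map ((algebraMap (LaurentSeries (ZMod p)) (LaurentSep p)).comp
    (HahnSeries.ofPowerSeries ℤ (ZMod p))) ∧
  φ.map PowerSeries.constantCoeff = (PowerSeries.X : PowerSeries (ZMod p))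

end BaseChange

end ChromaticFGL

/-! Write `x` for `y⁻¹`, `q = p^(n-1)`, `N = (p-1)q`, and let `σ` be the `q`-th power map on
coefficients. The `p`-series of `F₀` factors as `[p](t) = u(t^q)` with `u(t) = F₀(t, -x^N t^p)`.
This series is `t + ⋯`, and it is `t` modulo `x`. Since `[p]_H(t) = t^q` and `φ(t)^q = φ^σ(t^q)`, a
homomorphism `φ : F₀ → H` must satisfy the twisted equation `φ(u(t)) = φ^σ(t)`
(`IsHom.subst_reducedFactor`). For `φ = ∑ aₘ t^m` this reads `aₘ^q - aₘ = ∑_{i<m} aᵢ [t^m]u^i`, a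
sequence of Artin–Schreier equations.

Suppose that `a ↦ a^q - a` is bijective on the kernel of a map `κ` that kills `x`. The equations
then have a solution reducing to `t` (`exists_subst_eq_map`), and a solution is determined by its
reduction (`eq_of_subst_eq_map`). Injectivity also makes the solution a homomorphism
(`isHom_of_subst_eq_map`). Indeed `u` is a homomorphism `F₀^σ → F₀` and `H^σ = H`, so the defect `D
= φ(F₀(X, Y)) - H(φ(X), φ(Y))` satisfies `D^σ = D(u(X), u(Y))` and vanishes along `κ`. Its
lowest-degree coefficients are fixed by `σ` and killed by `κ`, hence are zero.

The ring to which this is applied consists of the elements of `𝔽_p(y)^s` paired with an expansion in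
`𝔽_p[[x]]`, and `κ` is the constant term. The equations are solved explicitly in `𝔽_p[[x]]`. Their
solutions come from `𝔽_p(y)^s` because Artin–Schreier polynomials are separable and already split
there (`expansionRing_exists_pow_sub_eq`). The two projections of the resulting series are `Φ` and
its expansion. Applying `ι₀` to `Φ` gives `Ψ`, and uniqueness descends along the injection `ι₀`.

The `p`-series is computed on a lift of `F₀` to `ℤ_p[x]`, which has a logarithm over `ℚ_p[x]`.
Araki's formula becomes `p ℓ(t) = ℓ(p t) + ℓ(t^q) + ℓ(-x^N t^(pq))`. Hence `[p](t)` is the formal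
sum of the three arguments, and the first one vanishes modulo `p`. As `p` is odd, `ℓ` is an odd
series and the formal inverse is negation. -/

namespace ChromaticFGL

open MvPowerSeries

/-! ### Substitution into power series and base change -/

section Composition

variable {R S : Type*} [CommRing R] [CommRing S] {σ τ : Type*}

lemma hasSubst_pair {a b : MvPowerSeries τ R} (ha : a.constantCoeff = 0)
    (hb : b.constantCoeff = 0) : HasSubst ![a, b] :=
  hasSubst_of_constantCoeff_zero fun s => by fin_cases s <;> simpa

lemma constantCoeff_subst_pair {F : MvPowerSeries (Fin 2) R} (hF : F.constantCoeff = 0)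
    {a b : MvPowerSeries τ R} (ha : a.constantCoeff = 0) (hb : b.constantCoeff = 0) :
    (F.subst ![a, b]).constantCoeff = 0 :=
  constantCoeff_subst_eq_zero (hasSubst_pair ha hb) (fun s => by fin_cases s <;> simpa) hF

lemma subst_subst_pair {a b : MvPowerSeries σ R} (ha : a.constantCoeff = 0)
    (hb : b.constantCoeff = 0) {c : σ → MvPowerSeries τ R} (hc : HasSubst c)
    (F : MvPowerSeries (Fin 2) R) :
    (F.subst ![a, b]).subst c = F.subst ![a.subst c, b.subst c] := by
  rw [subst_comp_subst_apply (hasSubst_pair ha hb) hc]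
  congr 1
  ext1 s
  fin_cases s <;> rfl

lemma map_subst_pair (f : R →+* S) {a b : MvPowerSeries τ R} (ha : a.constantCoeff = 0)
    (hb : b.constantCoeff = 0) (F : MvPowerSeries (Fin 2) R) :
    (F.subst ![a, b]).map f = (F.map f).subst ![a.map f, b.map f] := by
  rw [map_subst (hasSubst_pair ha hb)]
  congr 1
  ext1 s
  fin_cases s <;> rfl

lemma subst_subst_single {a : MvPowerSeries σ R} (ha : a.constantCoeff = 0)
    {c : σ → MvPowerSeries τ R} (hc : HasSubst c) (f : PowerSeries R) :
    MvPowerSeries.subst c (f.subst a) = f.subst (a.subst c) := by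
  rw [PowerSeries.subst, subst_comp_subst_apply (PowerSeries.HasSubst.of_constantCoeff_zero ha).const
    hc, PowerSeries.subst]

lemma map_subst_single (f : R →+* S) {a : MvPowerSeries τ R} (ha : a.constantCoeff = 0)
    (g : PowerSeries R) : (g.subst a).map f = (g.map f).subst (a.map f) :=
  PowerSeries.map_subst (PowerSeries.HasSubst.of_constantCoeff_zero ha) _

lemma subst_pair_X (F : MvPowerSeries (Fin 2) R) :
    F.subst ![(X 0 : MvPowerSeries (Fin 2) R), X 1] = F := by
  have : ![(X 0 : MvPowerSeries (Fin 2) R), X 1] = X := by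
    ext1 s; fin_cases s <;> rfl
  rw [this, subst_self, id]

lemma map_mv_injective {f : R →+* S} (hf : Function.Injective f) :
    Function.Injective (MvPowerSeries.map (σ := τ) f) := fun G H h => by
  ext d
  apply hf
  rw [← MvPowerSeries.coeff_map, h, MvPowerSeries.coeff_map]

lemma formalGroup_map_map {T : Type*} [CommRing T] (F : FormalGroup R) (f : R →+* S)
    (g : S →+* T) : (F.map f).map g = F.map (g.comp f) := by
  ext1
  simp only [FormalGroup.map_toPowerSeries]
  rw [← RingHom.comp_apply, ← MvPowerSeries.map_comp]

end Composition

/-! ### Homomorphisms of formal group laws -/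

section Homomorphisms

variable {R S : Type*} [CommRing R] [CommRing S] {τ : Type*}

lemma IsHom.subst_pair {F G : FormalGroup R} {φ : PowerSeries R} (h : IsHom F G φ)
    {a b : MvPowerSeries τ R} (ha : a.constantCoeff = 0) (hb : b.constantCoeff = 0) :
    φ.subst (F.toPowerSeries.subst ![a, b]) =
      G.toPowerSeries.subst ![φ.subst a, φ.subst b] := by
  have hab := hasSubst_pair ha hb
  have hX : ∀ i : Fin 2, (X i : MvPowerSeries (Fin 2) R).constantCoeff = 0 := fun i => by simp
  have := congrArg (MvPowerSeries.subst ![a, b]) h.2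
  rw [subst_subst_single F.zero_constantCoeff hab, subst_subst_pair
    (PowerSeries.constantCoeff_subst_eq_zero (hX 0) _ h.1)
    (PowerSeries.constantCoeff_subst_eq_zero (hX 1) _ h.1) hab, subst_subst_single (hX 0) hab,
    subst_subst_single (hX 1) hab, subst_X hab, subst_X hab] at this
  exact this

lemma constantCoeff_nSeries (F : FormalGroup R) (m : ℕ) :
    (nSeries F m).constantCoeff = 0 := by
  cases m with
  | zero => simp [nSeries]
  | succ m =>
    rw [nSeries]
    exact constantCoeff_subst_pair F.zero_constantCoeff (constantCoeff_nSeries F m)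
      PowerSeries.constantCoeff_X

lemma map_nSeries (f : R →+* S) (F : FormalGroup R) (m : ℕ) :
    (nSeries F m).map f = nSeries (F.map f) m := by
  induction m with
  | zero => simp [nSeries]
  | succ m ih =>
    rw [nSeries, nSeries, ← ih]
    refine (map_subst_pair f (constantCoeff_nSeries F m) PowerSeries.constantCoeff_X _).trans ?_
    congr
    exact PowerSeries.map_X f

/-- Induction on `m`. For `m = p` this is the relation from which the twisted equation is extracted.
-/
lemma IsHom.subst_nSeries {F G : FormalGroup R} {φ : PowerSeries R} (h : IsHom F G φ) (m : ℕ) :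
    φ.subst (nSeries F m) = (nSeries G m).subst φ := by
  have hφ : PowerSeries.HasSubst φ := PowerSeries.HasSubst.of_constantCoeff_zero' h.1
  induction m with
  | zero =>
    rw [nSeries, nSeries, PowerSeries.subst_zero_of_constantCoeff_zero h.1,
      ← PowerSeries.coe_substAlgHom hφ, map_zero]
  | succ m ih =>
    rw [nSeries, nSeries, h.subst_pair (constantCoeff_nSeries F m) PowerSeries.constantCoeff_X, ih,
      PowerSeries.X_subst, PowerSeries.subst_def φ, PowerSeries.subst_def φ,
      subst_subst_pair (constantCoeff_nSeries G m)
      PowerSeries.constantCoeff_X hφ.const]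
    congr
    exact (PowerSeries.subst_X hφ).symm

lemma constantCoeff_ps_map (f : R →+* S) (φ : PowerSeries R) :
    (φ.map f).constantCoeff = f φ.constantCoeff :=
  MvPowerSeries.constantCoeff_map f φ

lemma IsHom.map {F G : FormalGroup R} {φ : PowerSeries R} (h : IsHom F G φ) (f : R →+* S) :
    IsHom (F.map f) (G.map f) (φ.map f) := by
  have hX : ∀ i : Fin 2, (X i : MvPowerSeries (Fin 2) R).constantCoeff = 0 := fun i => by simp
  refine ⟨by rw [constantCoeff_ps_map, h.1, map_zero], ?_⟩
  have := congrArg (MvPowerSeries.map f) h.2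
  rwa [map_subst_single f F.zero_constantCoeff, map_subst_pair f
    (PowerSeries.constantCoeff_subst_eq_zero (hX 0) _ h.1)
    (PowerSeries.constantCoeff_subst_eq_zero (hX 1) _ h.1), map_subst_single f (hX 0),
    map_subst_single f (hX 1), map_X, map_X] at this

/-- The homomorphism condition is an identity of coefficients, so an injection reflects it. This
carries the uniqueness statements down to the ring where the equations are uniquely solvable. -/
lemma IsHom.of_map {F G : FormalGroup R} {φ : PowerSeries R} {f : R →+* S}
    (hf : Function.Injective f) (h : IsHom (F.map f) (G.map f) (φ.map f)) : IsHom F G φ := by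
  have hX : ∀ i : Fin 2, (X i : MvPowerSeries (Fin 2) R).constantCoeff = 0 := fun i => by simp
  have h1 : φ.constantCoeff = 0 := hf (by rw [← constantCoeff_ps_map, h.1, map_zero])
  refine ⟨h1, map_mv_injective hf ?_⟩
  rw [map_subst_single f F.zero_constantCoeff, map_subst_pair f
    (PowerSeries.constantCoeff_subst_eq_zero (hX 0) _ h1)
    (PowerSeries.constantCoeff_subst_eq_zero (hX 1) _ h1), map_subst_single f (hX 0),
    map_subst_single f (hX 1), map_X, map_X]
  exact h.2

/-- A homomorphism that is `t` modulo `t²` is a strict isomorphism. -/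
lemma IsHom.isStrictIso {F G : FormalGroup R} {φ : PowerSeries R} (h : IsHom F G φ)
    (h1 : φ.coeff 1 = 1) : IsStrictIso F G φ := by
  have : Invertible (φ.coeff 1) := h1 ▸ invertibleOne
  have hX : ∀ i : Fin 2, (X i : MvPowerSeries (Fin 2) R).constantCoeff = 0 := fun i => by simp
  have hψ0 : φ.substInv.constantCoeff = 0 := by simp
  have hψX : ∀ i : Fin 2, (φ.substInv.subst (X i : MvPowerSeries (Fin 2) R)).constantCoeff = 0 :=
    fun i => PowerSeries.constantCoeff_subst_eq_zero (hX i) _ hψ0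
  have hinv : ∀ {a : MvPowerSeries (Fin 2) R}, a.constantCoeff = 0 →
      φ.subst (φ.substInv.subst a) = a := fun {a} ha => by
    have ha' := PowerSeries.HasSubst.of_constantCoeff_zero ha
    rw [← PowerSeries.subst_comp_subst_apply (PowerSeries.HasSubst.substInv φ) ha',
      PowerSeries.subst_substInv_right φ h.1, PowerSeries.subst_X ha']
  refine ⟨⟨h, φ.substInv, ⟨hψ0, ?_⟩, PowerSeries.subst_substInv_left φ h.1,
    PowerSeries.subst_substInv_right φ h.1⟩, h1⟩
  -- `φ` takes the place of the logarithm here: only the cancellation of a series `t + ⋯` on the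
  -- left is used.
  refine subst_log_injective h.1 h1
    (PowerSeries.constantCoeff_subst_eq_zero G.zero_constantCoeff _ hψ0)
    (constantCoeff_subst_pair F.zero_constantCoeff (hψX 0) (hψX 1)) ?_
  rw [hinv G.zero_constantCoeff, h.subst_pair (hψX 0) (hψX 1), hinv (hX 0), hinv (hX 1),
    subst_pair_X]

end Homomorphisms

/-! ### The twisted equation `φ(u(t)) = φ^σ(t)` -/

section TwistedEquation

variable {R k : Type*} [CommRing R] [CommRing k] {τ : Type*}

lemma exists_eq_X_mul {u : PowerSeries R} (u0 : u.constantCoeff = 0) (u1 : u.coeff 1 = 1) :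
    ∃ v : PowerSeries R, v.constantCoeff = 1 ∧ u = PowerSeries.X * v := by
  obtain ⟨v, rfl⟩ := PowerSeries.X_dvd_iff.mpr u0
  refine ⟨v, ?_, rfl⟩
  rw [show (1 : ℕ) = 0 + 1 from rfl, PowerSeries.coeff_succ_X_mul] at u1
  simpa using u1

/-- Substituting a power series `t + ⋯` for each variable does not change the leading
coefficients. -/
lemma coeff_subst_of_lower_eq_zero [Finite τ] {u : PowerSeries R} (u0 : u.constantCoeff = 0)
    (u1 : u.coeff 1 = 1) {D : MvPowerSeries τ R} {e : τ →₀ ℕ}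
    (h : ∀ d : τ →₀ ℕ, d.degree < e.degree → coeff d D = 0) :
    coeff e (D.subst fun i => u.subst (X i : MvPowerSeries τ R)) = coeff e D := by
  obtain ⟨v, v0, rfl⟩ := exists_eq_X_mul u0 u1
  have hX : ∀ i : τ, PowerSeries.HasSubst (X i : MvPowerSeries τ R) := PowerSeries.HasSubst.X
  have hv : ∀ i : τ, (v.subst (X i : MvPowerSeries τ R)).constantCoeff = 1 := fun i => by
    have h1 : (1 : PowerSeries R).subst (X i : MvPowerSeries τ R) = 1 := by
      rw [← PowerSeries.coe_substAlgHom (hX i), map_one]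
    have := PowerSeries.constantCoeff_subst_eq_zero (a := (X i : MvPowerSeries τ R)) (by simp)
      (v - 1) (by simp [v0])
    rwa [PowerSeries.subst_sub (hX i), h1, map_sub, map_one, sub_eq_zero] at this
  have hU : (fun i => (PowerSeries.X * v).subst (X i : MvPowerSeries τ R)) =
      fun i => X i * v.subst (X i : MvPowerSeries τ R) := by
    ext1 i
    rw [PowerSeries.subst_mul (hX i), PowerSeries.subst_X (hX i)]
  have hs : HasSubst fun i => X i * v.subst (X i : MvPowerSeries τ R) :=
    hasSubst_of_constantCoeff_zero fun i => by simp
  have hprod : ∀ d : τ →₀ ℕ,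
      (d.prod fun i n => (X i * v.subst (X i : MvPowerSeries τ R)) ^ n) =
        monomial d 1 * d.prod fun i n => (v.subst (X i : MvPowerSeries τ R)) ^ n := fun d => by
    simp only [mul_pow, Finsupp.prod_mul, ← monomial_one_eq]
  -- The monomial with exponent `d` becomes `X^d` times a series with constant term `1`. It reaches
  -- `e` only if `d ≤ e`, and for `d ≠ e` the degree of `d` is smaller, so its coefficient in `D`
  -- vanishes.
  rw [hU, coeff_subst hs, finsum_eq_single _ e]
  · have : (e.prod fun i n => (v.subst (X i : MvPowerSeries τ R)) ^ n).constantCoeff = 1 := by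
      rw [map_finsuppProd]
      simp [hv]
    rw [hprod, coeff_monomial_mul, if_pos le_rfl, tsub_self,
      coeff_zero_eq_constantCoeff_apply, this, mul_one, smul_eq_mul, mul_one]
  · intro d hd
    rw [hprod, coeff_monomial_mul]
    split_ifs with hle
    · rw [h d, zero_smul]
      obtain ⟨c, rfl⟩ := exists_add_of_le hle
      rw [map_add]
      have : c.degree ≠ 0 := fun hc => hd (by
        rw [(Finsupp.degree_eq_zero_iff c).mp hc, add_zero])
      omega
    · rw [smul_zero]

variable {σ : R →+* R} {κ : R →+* k}

/-- Substituting `u = t + ⋯` leaves the lowest-degree coefficients unchanged, so the equation makes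
them fixed points of `σ` in the kernel of `κ`. In one variable this gives uniqueness of solutions;
in two variables it makes them homomorphisms. -/
lemma eq_zero_of_map_eq_subst [Finite τ] (hinj : ∀ a, κ a = 0 → σ a = a → a = 0)
    {u : PowerSeries R} (u0 : u.constantCoeff = 0) (u1 : u.coeff 1 = 1) {D : MvPowerSeries τ R}
    (hD : D.map σ = D.subst fun i => u.subst (X i : MvPowerSeries τ R)) (hκ : D.map κ = 0) :
    D = 0 := by
  suffices h : ∀ m (e : τ →₀ ℕ), e.degree = m → coeff e D = 0 by
    ext e
    exact h _ e rfl
  intro m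
  induction m using Nat.strong_induction_on with
  | _ m ih =>
    intro e he
    apply hinj
    · rw [← MvPowerSeries.coeff_map, hκ, map_zero]
    · rw [← MvPowerSeries.coeff_map, hD]
      exact coeff_subst_of_lower_eq_zero u0 u1 fun d hd => ih _ (he ▸ hd) d rfl

/-- The equation is additive in `φ`, so the difference of two solutions is again a solution, and it
vanishes along `κ`. -/
lemma eq_of_subst_eq_map (hinj : ∀ a, κ a = 0 → σ a = a → a = 0)
    {u : PowerSeries R} (u0 : u.constantCoeff = 0) (u1 : u.coeff 1 = 1) {φ ψ : PowerSeries R}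
    (hφ : φ.subst u = φ.map σ) (hψ : ψ.subst u = ψ.map σ) (h : φ.map κ = ψ.map κ) : φ = ψ := by
  rw [← sub_eq_zero]
  refine eq_zero_of_map_eq_subst hinj u0 u1 (κ := κ) (D := φ - ψ) ?_ ?_
  · have hu : (fun i : Unit => u.subst (X i : MvPowerSeries Unit R)) = fun _ => u := by
      ext1 i
      exact PowerSeries.X_subst u
    have := PowerSeries.subst_sub (PowerSeries.HasSubst.of_constantCoeff_zero' u0) φ ψ
    rw [hu, ← PowerSeries.subst_def, this, hφ, hψ]
    exact map_sub _ _ _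
  · exact (map_sub (PowerSeries.map κ) φ ψ).trans (sub_eq_zero.mpr h)

/-- If `σ a - a = b` can be solved in the kernel of `κ`, then the equation `φ(u(t)) = φ^σ(t)` has a
solution that reduces to `t` along `κ`. -/
theorem exists_subst_eq_map (hsol : ∀ b, κ b = 0 → ∃ a, κ a = 0 ∧ σ a - a = b)
    {u : PowerSeries R} (u0 : u.constantCoeff = 0) (u1 : u.coeff 1 = 1)
    (uκ : u.map κ = PowerSeries.X) :
    ∃ φ : PowerSeries R, φ.constantCoeff = 0 ∧ φ.coeff 1 = 1 ∧ φ.map κ = PowerSeries.X ∧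
      φ.subst u = φ.map σ := by
  choose! sol hsol using hsol
  -- As `u^m = t^m + ⋯`, the coefficient of `t^m` in the equation is `aₘ + ∑_{i<m} aᵢ [t^m]u^i = σ
  -- aₘ`, which determines `aₘ` through `sol`. In degrees `0` and `1` it only asks that `σ` fix `0`
  -- and `1`, so these values can be prescribed.
  obtain ⟨a, a0, a1, ha⟩ : ∃ a : ℕ → R, a 0 = 0 ∧ a 1 = 1 ∧ ∀ m, 2 ≤ m →
      a m = sol (∑ i ∈ Finset.range m, a i * (u ^ i).coeff m) := by
    let a : ℕ → R := fun m => Nat.strongRec (fun m ih => if m = 0 then 0 else if m = 1 then 1 else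
      sol (∑ i : Fin m, ih i.1 i.2 * (u ^ i.1).coeff m)) m
    have h : ∀ m, a m = if m = 0 then 0 else if m = 1 then 1 else
        sol (∑ i : Fin m, a i.1 * (u ^ i.1).coeff m) := fun m => Nat.strongRec.eq_1 _ _
    refine ⟨a, by rw [h, if_pos rfl], by rw [h, if_neg one_ne_zero, if_pos rfl], fun m hm => ?_⟩
    rw [h, if_neg (by omega), if_neg (by omega),
      Fin.sum_univ_eq_sum_range (fun i => a i * (u ^ i).coeff m)]
  have huκ : ∀ m, 2 ≤ m → κ (u.coeff m) = 0 := fun m hm => by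
    rw [← PowerSeries.coeff_map, uκ, PowerSeries.coeff_X, if_neg (by omega)]
  -- The right-hand side must lie in the kernel of `κ` for `sol` to apply: the term `i = 1` does
  -- because `u` reduces to `t`, the later ones by induction.
  have hsum : ∀ m, 2 ≤ m → (∀ i, 2 ≤ i → i < m → κ (a i) = 0) →
      κ (∑ i ∈ Finset.range m, a i * (u ^ i).coeff m) = 0 := fun m hm h => by
    rw [map_sum]
    refine Finset.sum_eq_zero fun i hi => ?_
    rw [map_mul]
    rcases i with _ | _ | i
    · rw [a0, map_zero, zero_mul]
    · rw [zero_add, pow_one, huκ m hm, mul_zero]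
    · rw [h _ (by omega) (Finset.mem_range.mp hi), zero_mul]
  have haκ : ∀ m, 2 ≤ m → κ (a m) = 0 := fun m => by
    induction m using Nat.strong_induction_on with
    | _ m ih =>
      intro hm
      rw [ha m hm]
      exact (hsol _ (hsum m hm fun i hi him => ih i him hi)).1
  obtain ⟨v, v0, hv⟩ := exists_eq_X_mul u0 u1
  have hlt : ∀ {m i : ℕ}, m < i → (u ^ i).coeff m = 0 := fun {m i} h => by
    rw [hv, mul_pow, PowerSeries.coeff_X_pow_mul', if_neg (by omega)]
  have hself : ∀ m, (u ^ m).coeff m = 1 := fun m => by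
    rw [hv, mul_pow, PowerSeries.coeff_X_pow_mul', if_pos le_rfl, Nat.sub_self]
    simp [v0]
  refine ⟨PowerSeries.mk a, by simp [a0], by simp [a1], ?_, ?_⟩
  · ext m
    rw [PowerSeries.coeff_map, PowerSeries.coeff_mk, PowerSeries.coeff_X]
    rcases m with _ | _ | m
    · simp [a0]
    · simp [a1]
    · rw [haκ _ (by omega), if_neg (by omega)]
  · ext m
    rw [PowerSeries.coeff_subst' (PowerSeries.HasSubst.of_constantCoeff_zero' u0),
      finsum_eq_sum_of_support_subset (s := Finset.range (m + 1))]
    · simp only [PowerSeries.coeff_mk, smul_eq_mul, PowerSeries.coeff_map]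
      rw [Finset.sum_range_succ, hself, mul_one]
      rcases m with _ | _ | m
      · simp [a0]
      · simp [a0, a1]
      · rw [← (hsol _ (hsum (m + 2) (by omega) fun i hi _ => haκ i hi)).2, ← ha _ (by omega)]
        ring
    · intro i hi
      rw [Function.mem_support] at hi
      by_contra him
      apply hi
      rw [hlt (by simpa using him), smul_zero]

/-- A solution of the equation `φ(u(t)) = φ^σ(t)` that reduces to `t` along `κ` is a homomorphism
of formal group laws, if `u` is one. -/
theorem isHom_of_subst_eq_map (hinj : ∀ a, κ a = 0 → σ a = a → a = 0)
    {F G : FormalGroup R} (hFG : F.map κ = G.map κ) (hG : G.map σ = G) {u : PowerSeries R}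
    (u1 : u.coeff 1 = 1) (hu : IsHom (F.map σ) F u) {φ : PowerSeries R}
    (h0 : φ.constantCoeff = 0) (hφκ : φ.map κ = PowerSeries.X) (hφ : φ.subst u = φ.map σ) :
    IsHom F G φ := by
  have u0 := hu.1
  have hX : ∀ i : Fin 2, (X i : MvPowerSeries (Fin 2) R).constantCoeff = 0 := fun i => by simp
  have hφX : ∀ i : Fin 2, (φ.subst (X i : MvPowerSeries (Fin 2) R)).constantCoeff = 0 :=
    fun i => PowerSeries.constantCoeff_subst_eq_zero (hX i) _ h0
  have huX : ∀ i : Fin 2, (u.subst (X i : MvPowerSeries (Fin 2) R)).constantCoeff = 0 :=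
    fun i => PowerSeries.constantCoeff_subst_eq_zero (hX i) _ u0
  have hU : HasSubst fun i : Fin 2 => u.subst (X i : MvPowerSeries (Fin 2) R) :=
    hasSubst_of_constantCoeff_zero huX
  have hUpair : (fun i : Fin 2 => u.subst (X i : MvPowerSeries (Fin 2) R)) =
      ![u.subst (X 0 : MvPowerSeries (Fin 2) R), u.subst (X 1 : MvPowerSeries (Fin 2) R)] := by
    ext1 i; fin_cases i <;> rfl
  have hcomp : ∀ {a : MvPowerSeries (Fin 2) R}, a.constantCoeff = 0 →
      (φ.map σ).subst a = φ.subst (u.subst a) := fun {a} ha => by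
    rw [← hφ, PowerSeries.subst_comp_subst_apply (PowerSeries.HasSubst.of_constantCoeff_zero' u0)
      (PowerSeries.HasSubst.of_constantCoeff_zero ha)]
  refine ⟨h0, ?_⟩
  rw [← sub_eq_zero]
  -- The defect satisfies the twisted equation in two variables: applying `σ` replaces `φ` by `φ ∘
  -- u`, and `u` turns `F^σ` into `F`. It vanishes along `κ` because there `φ` is `t` and the two
  -- laws agree.
  refine eq_zero_of_map_eq_subst hinj u0 u1 (κ := κ) ?_ ?_
  · rw [map_sub, subst_sub hU, map_subst_single σ F.zero_constantCoeff,
      map_subst_pair σ (hφX 0) (hφX 1), map_subst_single σ (hX 0), map_subst_single σ (hX 1),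
      map_X, map_X, subst_subst_single F.zero_constantCoeff hU,
      subst_subst_pair (hφX 0) (hφX 1) hU, subst_subst_single (hX 0) hU,
      subst_subst_single (hX 1) hU, subst_X hU, subst_X hU, hcomp (hX 0), hcomp (hX 1),
      ← FormalGroup.map_toPowerSeries F, ← FormalGroup.map_toPowerSeries G,
      hcomp (F.map σ).zero_constantCoeff, hG, hu.2, hUpair]
  · have hXκ : ∀ i : Fin 2, PowerSeries.HasSubst (X i : MvPowerSeries (Fin 2) k) :=
      PowerSeries.HasSubst.X
    rw [map_sub, map_subst_single κ F.zero_constantCoeff, map_subst_pair κ (hφX 0) (hφX 1),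
      map_subst_single κ (hX 0), map_subst_single κ (hX 1), map_X, map_X, hφκ,
      PowerSeries.subst_X (hXκ 0), PowerSeries.subst_X (hXκ 1), subst_pair_X,
      ← FormalGroup.map_toPowerSeries F, ← FormalGroup.map_toPowerSeries G, hFG,
      PowerSeries.subst_X, sub_self]
    exact PowerSeries.HasSubst.of_constantCoeff_zero (G.map κ).zero_constantCoeff

end TwistedEquation

/-! ### Logarithms and the `m`-series -/

section Logarithm

variable {A K : Type*} [CommRing A] [CommRing K] {τ : Type*}

/-- `ℓ` is a logarithm of the image of `F` under `i`. -/
def IsLogOf (i : A →+* K) (F : FormalGroup A) (ℓ : PowerSeries K) : Prop :=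
  (ℓ.constantCoeff = 0 ∧ ℓ.coeff 1 = 1) ∧
    ℓ.subst (F.map i).toPowerSeries = ℓ.subst (X 0 : MvPowerSeries (Fin 2) K) +
      ℓ.subst (X 1 : MvPowerSeries (Fin 2) K)

variable {i : A →+* K} {F : FormalGroup A} {ℓ : PowerSeries K}

lemma IsLogOf.subst_pair (h : IsLogOf i F ℓ) {a b : MvPowerSeries τ A}
    (ha : a.constantCoeff = 0) (hb : b.constantCoeff = 0) :
    ℓ.subst ((F.toPowerSeries.subst ![a, b]).map i) = ℓ.subst (a.map i) + ℓ.subst (b.map i) := by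
  have hX : ∀ j : Fin 2, (X j : MvPowerSeries (Fin 2) K).constantCoeff = 0 := fun j => by simp
  have hab := hasSubst_pair (a := a.map i) (b := b.map i)
    (by rw [constantCoeff_map, ha, map_zero]) (by rw [constantCoeff_map, hb, map_zero])
  have := congrArg (MvPowerSeries.subst ![a.map i, b.map i]) h.2
  rw [subst_add hab, subst_subst_single (F.map i).zero_constantCoeff hab,
    subst_subst_single (hX 0) hab, subst_subst_single (hX 1) hab, subst_X hab, subst_X hab] at this
  rw [map_subst_pair i ha hb]
  exact this

/-- The principle behind the computation of the `p`-series: identities over `A` are checked after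
applying the logarithm over `K`, where formal sums become ordinary sums. -/
lemma IsLogOf.eq_of_subst_eq (h : IsLogOf i F ℓ) (hi : Function.Injective i)
    {a b : MvPowerSeries τ A} (ha : a.constantCoeff = 0) (hb : b.constantCoeff = 0)
    (hab : ℓ.subst (a.map i) = ℓ.subst (b.map i)) : a = b :=
  map_mv_injective hi <| subst_log_injective h.1.1 h.1.2
    (by rw [constantCoeff_map, ha, map_zero]) (by rw [constantCoeff_map, hb, map_zero]) hab

lemma IsLogOf.subst_nSeries (h : IsLogOf i F ℓ) (m : ℕ) :
    ℓ.subst ((nSeries F m).map i) = m • ℓ := by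
  induction m with
  | zero =>
    rw [nSeries, map_zero, PowerSeries.subst_zero_of_constantCoeff_zero h.1.1, zero_smul]
  | succ m ih =>
    rw [nSeries, add_smul, one_smul, ← ih]
    refine (h.subst_pair (constantCoeff_nSeries F m) PowerSeries.constantCoeff_X).trans ?_
    congr 1
    exact (congrArg ℓ.subst (PowerSeries.map_X i)).trans (PowerSeries.X_subst ℓ)

lemma IsLogOf.subst_nSeries_subst (h : IsLogOf i F ℓ) (m : ℕ) {a : MvPowerSeries τ A}
    (ha : a.constantCoeff = 0) :
    ℓ.subst (((nSeries F m).subst a).map i) = m • ℓ.subst (a.map i) := by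
  have ha' : PowerSeries.HasSubst (a.map i) := PowerSeries.HasSubst.of_constantCoeff_zero
    (by rw [constantCoeff_map, ha, map_zero])
  have h0 : ((nSeries F m).map i).constantCoeff = 0 := by
    rw [constantCoeff_ps_map, constantCoeff_nSeries, map_zero]
  rw [map_subst_single i ha, ← PowerSeries.subst_comp_subst_apply
    (PowerSeries.HasSubst.of_constantCoeff_zero' h0) ha', h.subst_nSeries,
    ← PowerSeries.coe_substAlgHom ha', map_nsmul]

/-- The `m`-series of a formal group law with a logarithm is an endomorphism. -/
theorem IsLogOf.isHom_nSeries (h : IsLogOf i F ℓ) (hi : Function.Injective i) (m : ℕ) :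
    IsHom F F (nSeries F m) := by
  have hX : ∀ j : Fin 2, (X j : MvPowerSeries (Fin 2) A).constantCoeff = 0 := fun j => by simp
  have h0 := constantCoeff_nSeries F m
  have hmX : ∀ j : Fin 2,
      ((nSeries F m).subst (X j : MvPowerSeries (Fin 2) A)).constantCoeff = 0 :=
    fun j => PowerSeries.constantCoeff_subst_eq_zero (hX j) _ h0
  refine ⟨h0, h.eq_of_subst_eq hi
    (PowerSeries.constantCoeff_subst_eq_zero F.zero_constantCoeff _ h0)
    (constantCoeff_subst_pair F.zero_constantCoeff (hmX 0) (hmX 1)) ?_⟩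
  -- Both sides have logarithm `m (ℓ(X) + ℓ(Y))`.
  rw [h.subst_nSeries_subst m F.zero_constantCoeff, h.subst_pair (hmX 0) (hmX 1),
    h.subst_nSeries_subst m (hX 0), h.subst_nSeries_subst m (hX 1), map_X, map_X, ← smul_add,
    ← h.2, FormalGroup.map_toPowerSeries]

end Logarithm

/-! ### Series supported on powers of `p` -/

section PTypicalSeries

variable {R : Type*} [CommRing R] {p : ℕ}

/-- All exponents `p^k` are odd. This is where `p ≠ 2` enters: the formal inverse for such a
logarithm is plain negation. -/
lemma subst_neg_pSeriesOf (hp : 1 < p) (hodd : Odd p) (a : ℕ → R) {τ : Type*}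
    {G : MvPowerSeries τ R} (hG : G.constantCoeff = 0) :
    (pSeriesOf p a).subst (-G) = -(pSeriesOf p a).subst G := by
  ext e
  rw [map_neg, coeff_subst_pSeriesOf hp a (by rw [map_neg, hG, neg_zero]) (Nat.lt_succ_self _),
    coeff_subst_pSeriesOf hp a hG (Nat.lt_succ_self _), ← Finset.sum_neg_distrib]
  refine Finset.sum_congr rfl fun k _ => ?_
  rw [Odd.neg_pow (hodd.pow), map_neg, mul_neg]

/-- Substituting `b t^(p^r)` shifts the coefficients by `r` places with weights `b^(p^k)`, which is
the shape of the terms in Araki's recursion. -/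
lemma pSeriesOf_subst_monomial (hp : 1 < p) (a : ℕ → R) (b : R) (r : ℕ) :
    (pSeriesOf p a).subst (PowerSeries.C b * PowerSeries.X ^ p ^ r : PowerSeries R) =
      pSeriesOf p fun k => if r ≤ k then a (k - r) * b ^ p ^ (k - r) else 0 := by
  have h0 : (PowerSeries.C b * PowerSeries.X ^ p ^ r : PowerSeries R).constantCoeff = 0 := by
    rw [map_mul, map_pow, PowerSeries.constantCoeff_X, zero_pow (pow_pos (by omega) r).ne',
      mul_zero]
  have hpow : ∀ m k, ((PowerSeries.C b * PowerSeries.X ^ p ^ r : PowerSeries R) ^ p ^ k).coeff m =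
      if m = p ^ (r + k) then b ^ p ^ k else 0 := fun m k => by
    rw [mul_pow, ← map_pow, ← pow_mul, ← pow_add, PowerSeries.coeff_C_mul, PowerSeries.coeff_X_pow,
      mul_ite, mul_one, mul_zero]
  ext m
  have hm := coeff_subst_pSeriesOf hp a h0 (e := Finsupp.single () m) (N := m + 1) (by simp)
  refine hm.trans ((Finset.sum_congr rfl fun k _ => congrArg (a k * ·) (hpow m k)).trans ?_)
  by_cases h : ∃ j, m = p ^ j
  · obtain ⟨j, rfl⟩ := h
    have hj := Nat.lt_pow_self hp (n := j)
    simp only [(Nat.pow_right_injective hp).eq_iff, mul_ite, mul_zero]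
    rw [coeff_pSeriesOf_pow hp]
    split_ifs with hr
    · rw [Finset.sum_eq_single (j - r), if_pos (by omega)]
      · intro k _ hk
        rw [if_neg (by omega)]
      · intro hk
        exact absurd (Finset.mem_range.mpr (by omega)) hk
    · exact Finset.sum_eq_zero fun k _ => if_neg (by omega)
  · push Not at h
    rw [coeff_pSeriesOf_of_ne _ h]
    exact Finset.sum_eq_zero fun k _ => by rw [if_neg (h _), mul_zero]

lemma pSeriesOf_add (a b : ℕ → R) :
    pSeriesOf p (fun k => a k + b k) = pSeriesOf p a + pSeriesOf p b := by
  ext m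
  simp only [pSeriesOf, map_add, PowerSeries.coeff_mk]
  split_ifs <;> simp

lemma pSeriesOf_nsmul (n : ℕ) (a : ℕ → R) :
    pSeriesOf p (fun k => n • a k) = n • pSeriesOf p a := by
  ext m
  simp only [pSeriesOf, map_nsmul, PowerSeries.coeff_mk]
  split_ifs <;> simp

end PTypicalSeries

/-! ### A lift of `F₀` to characteristic zero and its logarithm -/

section Lift

variable (p n : ℕ) [Fact p.Prime]

/-- The values of the generators `v_{i+1}` that define `F₀`, over any base. -/
noncomputable def genValue (R : Type*) [CommRing R] (i : ℕ) : Polynomial R :=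
  if i + 1 = n - 1 then 1
  else if i + 1 = n then -Polynomial.X ^ ((p - 1) * p ^ (n - 1))
  else 0

/-- A lift of `F₀` to `ℤ_p[x]`. -/
noncomputable def liftedLaw : FormalGroup (Polynomial ℤ_[p]) :=
  (arakiLaw p).map (MvPolynomial.eval₂Hom Polynomial.C (genValue p n ℤ_[p]))

/-- The coefficients of the logarithm of the lift of `F₀`. -/
noncomputable def liftedLogCoeff (k : ℕ) : Polynomial ℚ_[p] :=
  MvPolynomial.eval₂Hom Polynomial.C (genValue p n ℚ_[p]) (arakiLogCoeff p k)

lemma liftedLaw_map_toZMod :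
    (liftedLaw p n).map (Polynomial.mapRingHom PadicInt.toZMod) = reducedLaw p n := by
  rw [liftedLaw, reducedLaw, arakiLawMod, formalGroup_map_map]
  congr 1
  refine MvPolynomial.ringHom_ext (fun a => ?_) fun i => ?_
  · simp
  · simp only [RingHom.comp_apply, MvPolynomial.coe_eval₂Hom, MvPolynomial.eval₂_X, genValue]
    split_ifs <;> simp

lemma isLogOf_liftedLaw : IsLogOf (Polynomial.mapRingHom (algebraMap ℤ_[p] ℚ_[p]))
    (liftedLaw p n) (pSeriesOf p (liftedLogCoeff p n)) := by
  have hp : 1 < p := (Fact.out : p.Prime).one_lt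
  have hX : ∀ j : Fin 2, (X j : MvPowerSeries (Fin 2) (MvPolynomial ℕ ℚ_[p])).constantCoeff = 0 :=
    fun j => by simp
  refine ⟨⟨constantCoeff_pSeriesOf hp _, ?_⟩, ?_⟩
  · rw [coeff_one_pSeriesOf hp, liftedLogCoeff, arakiLogCoeff, map_one]
  set θ := MvPolynomial.eval₂Hom Polynomial.C (genValue p n ℚ_[p])
  have h := congrArg (MvPowerSeries.map θ) (arakiLog_subst_arakiLaw p)
  have hl : (arakiLog p).map θ = pSeriesOf p (liftedLogCoeff p n) := map_pSeriesOf p _ θ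
  rw [map_add, map_subst_single θ (hX 0), map_subst_single θ (hX 1), map_X, map_X,
    map_subst_single θ ((arakiLaw p).map _).zero_constantCoeff, hl,
    ← FormalGroup.map_toPowerSeries, formalGroup_map_map] at h
  rw [liftedLaw, formalGroup_map_map, ← h]
  congr 3
  refine MvPolynomial.ringHom_ext (fun a => ?_) fun i => ?_
  · simp [θ, toRational]
  · simp only [RingHom.comp_apply, MvPolynomial.coe_eval₂Hom, MvPolynomial.eval₂_X, genValue, θ,
      toRational, MvPolynomial.map_X]
    split_ifs <;> simp

variable {n}

/-- Only `v₀`, `v_{n-1}` and `vₙ` are nonzero, so three terms of Araki's sum survive. The vacuous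
condition `0 ≤ k` and the trivial powers of `1` keep the form of `pSeriesOf_subst_monomial` with `r
= 0`, `n - 1` and `n`. -/
lemma liftedLogCoeff_eq (hn : 1 < n) (k : ℕ) : p • liftedLogCoeff p n k =
    (if 0 ≤ k then liftedLogCoeff p n (k - 0) * (p : Polynomial ℚ_[p]) ^ p ^ (k - 0) else 0) +
    ((if n - 1 ≤ k then liftedLogCoeff p n (k - (n - 1)) * 1 ^ p ^ (k - (n - 1)) else 0) +
    if n ≤ k then liftedLogCoeff p n (k - n) *
      (-Polynomial.X ^ ((p - 1) * p ^ (n - 1))) ^ p ^ (k - n) else 0) := by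
  have hp : 1 < p := (Fact.out : p.Prime).one_lt
  set θ := MvPolynomial.eval₂Hom Polynomial.C (genValue p n ℚ_[p]) with hθ
  set c : Polynomial ℚ_[p] := -Polynomial.X ^ ((p - 1) * p ^ (n - 1)) with hc
  have hw : ∀ j m, θ (toRational p (arakiGen p j)) ^ p ^ m =
      -- The three cases exclude each other because `n > 1` keeps `n - 1` apart from `0`.
      (if j = 0 then (p : Polynomial ℚ_[p]) ^ p ^ m else 0) +
        ((if j = n - 1 then 1 ^ p ^ m else 0) + if j = n then c ^ p ^ m else 0) := fun j m => by
    have hm : p ^ m ≠ 0 := (pow_pos (by omega) m).ne'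
    rcases j with _ | j
    · rw [arakiGen, map_natCast, map_natCast, if_pos rfl, if_neg (by omega), if_neg (by omega),
        add_zero, add_zero]
    · rw [if_neg (Nat.succ_ne_zero j), zero_add, arakiGen, toRational, MvPolynomial.map_X, hθ,
        MvPolynomial.coe_eval₂Hom, MvPolynomial.eval₂_X, genValue]
      by_cases h1 : j + 1 = n - 1
      · rw [if_pos h1, if_pos h1, if_neg (by omega), add_zero]
      · rw [if_neg h1, if_neg h1, zero_add]
        by_cases h2 : j + 1 = n
        · rw [if_pos h2, if_pos h2]
        · rw [if_neg h2, if_neg h2, zero_pow hm]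
  have hsum : ∀ (b : Polynomial ℚ_[p]) (j : ℕ), ∑ m ∈ Finset.range (k + 1),
      liftedLogCoeff p n m * (if k - m = j then b ^ p ^ m else 0) =
      if j ≤ k then liftedLogCoeff p n (k - j) * b ^ p ^ (k - j) else 0 := fun b j => by
    split_ifs with hj
    · rw [Finset.sum_eq_single (k - j), if_pos (by omega)]
      · intro m hm hmk
        rw [Finset.mem_range] at hm
        rw [if_neg (by omega), mul_zero]
      · intro hk
        exact absurd (Finset.mem_range.mpr (by omega)) hk
    · exact Finset.sum_eq_zero fun m _ => by rw [if_neg (by omega), mul_zero]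
  rw [← hsum, ← hsum, ← hsum, ← Finset.sum_add_distrib, ← Finset.sum_add_distrib]
  have := congrArg θ (arakiLogCoeff_eq p k)
  rw [map_mul, map_natCast, map_sum] at this
  rw [nsmul_eq_mul, liftedLogCoeff, this]
  refine Finset.sum_congr rfl fun m _ => ?_
  rw [map_mul, map_pow, hw, ← mul_add, ← mul_add, liftedLogCoeff]

/-- Araki's formula for the logarithm of the lift of `F₀`. -/
lemma nsmul_liftedLog (hn : 1 < n) : p • pSeriesOf p (liftedLogCoeff p n) =
    (pSeriesOf p (liftedLogCoeff p n)).subst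
      (PowerSeries.C (p : Polynomial ℚ_[p]) * PowerSeries.X ^ p ^ 0 : PowerSeries _) +
    ((pSeriesOf p (liftedLogCoeff p n)).subst
      (PowerSeries.C (1 : Polynomial ℚ_[p]) * PowerSeries.X ^ p ^ (n - 1) : PowerSeries _) +
    (pSeriesOf p (liftedLogCoeff p n)).subst
      (PowerSeries.C (-Polynomial.X ^ ((p - 1) * p ^ (n - 1)) : Polynomial ℚ_[p]) *
        PowerSeries.X ^ p ^ n : PowerSeries _)) := by
  have hp : 1 < p := (Fact.out : p.Prime).one_lt
  rw [pSeriesOf_subst_monomial hp, pSeriesOf_subst_monomial hp, pSeriesOf_subst_monomial hp,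
    ← pSeriesOf_add, ← pSeriesOf_add, ← pSeriesOf_nsmul]
  congr 1
  ext1 k
  exact liftedLogCoeff_eq p hn k

end Lift

/-! ### The `p`-series of `F₀` -/

section PSeries

/-- The monomial `x^((p-1)q) t^(pq)` over any base. -/
noncomputable def topTerm (p n : ℕ) (R : Type*) [CommRing R] : PowerSeries (Polynomial R) :=
  PowerSeries.C (Polynomial.X ^ ((p - 1) * p ^ (n - 1))) * PowerSeries.X ^ p ^ n

lemma map_topTerm (p n : ℕ) {R S : Type*} [CommRing R] [CommRing S] (f : R →+* S) :
    (topTerm p n R).map (Polynomial.mapRingHom f) = topTerm p n S := by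
  simp [topTerm]

lemma map_subst_pair' {R S : Type*} [CommRing R] [CommRing S] (f : R →+* S) {a b : PowerSeries R}
    (ha : a.constantCoeff = 0) (hb : b.constantCoeff = 0) (F : MvPowerSeries (Fin 2) R) :
    PowerSeries.map f (F.subst ![a, b]) =
      (F.map f).subst ![PowerSeries.map f a, PowerSeries.map f b] :=
  map_subst_pair f ha hb F

variable (p n : ℕ) [Fact p.Prime]

lemma constantCoeff_X_pow_pow {R : Type*} [CommRing R] (r : ℕ) :
    (PowerSeries.X ^ p ^ r : PowerSeries R).constantCoeff = 0 := by
  rw [map_pow, PowerSeries.constantCoeff_X, zero_pow (pow_pos (Fact.out : p.Prime).pos r).ne']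

lemma constantCoeff_topTerm (R : Type*) [CommRing R] : (topTerm p n R).constantCoeff = 0 := by
  rw [topTerm, map_mul, constantCoeff_X_pow_pow, mul_zero]

lemma rational_injective : Function.Injective
    (Polynomial.mapRingHom (algebraMap ℤ_[p] ℚ_[p])) :=
  Polynomial.map_injective _ (FaithfulSMul.algebraMap_injective _ _)

variable {p n}

/-- The logarithm of the lift of `F₀` at the `p`-series. -/
lemma liftedLog_subst_nSeries (hp2 : p ≠ 2) (hn : 1 < n) :
    (pSeriesOf p (liftedLogCoeff p n)).subst
        ((nSeries (liftedLaw p n) p).map (Polynomial.mapRingHom (algebraMap ℤ_[p] ℚ_[p]))) =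
      (pSeriesOf p (liftedLogCoeff p n)).subst ((PowerSeries.C (p : Polynomial ℤ_[p]) *
          PowerSeries.X).map
            (Polynomial.mapRingHom (algebraMap ℤ_[p] ℚ_[p]))) +
        ((pSeriesOf p (liftedLogCoeff p n)).subst
          ((PowerSeries.X ^ p ^ (n - 1) : PowerSeries (Polynomial ℤ_[p])).map
            (Polynomial.mapRingHom (algebraMap ℤ_[p] ℚ_[p]))) -
        (pSeriesOf p (liftedLogCoeff p n)).subst
          ((topTerm p n ℤ_[p]).map (Polynomial.mapRingHom (algebraMap ℤ_[p] ℚ_[p])))) := by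
  have hp : 1 < p := (Fact.out : p.Prime).one_lt
  have hodd : Odd p := (Fact.out : p.Prime).odd_of_ne_two hp2
  rw [(isLogOf_liftedLaw p n).subst_nSeries, nsmul_liftedLog p hn, map_topTerm, sub_eq_add_neg,
    ← subst_neg_pSeriesOf hp hodd _ (constantCoeff_topTerm p n _), topTerm, map_neg, neg_mul]
  simp

/-- The identity `[p](t) = p t + (t^q - x^((p-1)q) t^(pq))` for the lift of `F₀`, where the
operations on the right are those of the formal group law. -/
lemma nSeries_liftedLaw (hp2 : p ≠ 2) (hn : 1 < n) : nSeries (liftedLaw p n) p =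
    (liftedLaw p n).toPowerSeries.subst ![(PowerSeries.C (p : Polynomial ℤ_[p]) *
      PowerSeries.X : PowerSeries _), (liftedLaw p n).toPowerSeries.subst
        ![(PowerSeries.X ^ p ^ (n - 1) : PowerSeries (Polynomial ℤ_[p])), -topTerm p n ℤ_[p]]] := by
  have hp : 1 < p := (Fact.out : p.Prime).one_lt
  have hodd : Odd p := (Fact.out : p.Prime).odd_of_ne_two hp2
  have h := isLogOf_liftedLaw p n
  have hF := (liftedLaw p n).zero_constantCoeff
  have h1 : (PowerSeries.C (p : Polynomial ℤ_[p]) *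
    PowerSeries.X : PowerSeries _).constantCoeff = 0 := by simp
  have h2 := constantCoeff_X_pow_pow p (R := Polynomial ℤ_[p]) (n - 1)
  have h3 := constantCoeff_topTerm p n ℤ_[p]
  have h3' : (-topTerm p n ℤ_[p]).constantCoeff = 0 := by rw [map_neg, h3, neg_zero]
  have h23 := constantCoeff_subst_pair hF h2 h3'
  refine h.eq_of_subst_eq (rational_injective p) (constantCoeff_nSeries _ _)
    (constantCoeff_subst_pair hF h1 h23) ?_
  rw [h.subst_pair h1 h23, h.subst_pair h2 h3', map_neg, subst_neg_pSeriesOf hp hodd _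
    (by rw [constantCoeff_map]; exact (congrArg _ h3).trans (map_zero _)), ← sub_eq_add_neg]
  exact liftedLog_subst_nSeries hp2 hn

/-- Comparison of logarithms again, with the subtracted term moved to the left. Its reduction modulo
`p` expresses the `p`-series of `F₀` without naming a formal inverse. -/
lemma nSeries_liftedLaw_add (hp2 : p ≠ 2) (hn : 1 < n) :
    (liftedLaw p n).toPowerSeries.subst ![nSeries (liftedLaw p n) p, topTerm p n ℤ_[p]] =
    (liftedLaw p n).toPowerSeries.subst ![(PowerSeries.C (p : Polynomial ℤ_[p]) *
      PowerSeries.X : PowerSeries _), (PowerSeries.X ^ p ^ (n - 1) : PowerSeries _)] := by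
  have h := isLogOf_liftedLaw p n
  have hF := (liftedLaw p n).zero_constantCoeff
  have h1 : (PowerSeries.C (p : Polynomial ℤ_[p]) *
    PowerSeries.X : PowerSeries _).constantCoeff = 0 := by simp
  have h2 := constantCoeff_X_pow_pow p (R := Polynomial ℤ_[p]) (n - 1)
  have h3 := constantCoeff_topTerm p n ℤ_[p]
  have h4 := constantCoeff_nSeries (liftedLaw p n) p
  refine h.eq_of_subst_eq (rational_injective p) (constantCoeff_subst_pair hF h4 h3)
    (constantCoeff_subst_pair hF h1 h2) ?_
  rw [h.subst_pair h1 h2, h.subst_pair h4 h3]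
  refine (congrArg (· + _) (liftedLog_subst_nSeries hp2 hn)).trans ?_
  refine (add_assoc _ _ _).trans (congrArg _ ?_)
  exact sub_add_cancel _ _

lemma map_natCast_mul_X : PowerSeries.map (Polynomial.mapRingHom PadicInt.toZMod)
    (PowerSeries.C (p : Polynomial ℤ_[p]) * PowerSeries.X) = 0 := by
  rw [map_mul, PowerSeries.map_C, map_natCast, CharP.cast_eq_zero (Polynomial (ZMod p)) p, map_zero,
    zero_mul]

lemma map_X_pow {R S : Type*} [CommRing R] [CommRing S] (f : R →+* S) (r : ℕ) :
    PowerSeries.map f (PowerSeries.X ^ r) = PowerSeries.X ^ r := by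
  rw [map_pow, PowerSeries.map_X]

/-- The `p`-series of `F₀`. -/
theorem nSeries_reducedLaw_add (hp2 : p ≠ 2) (hn : 1 < n) :
    (reducedLaw p n).toPowerSeries.subst ![nSeries (reducedLaw p n) p, topTerm p n (ZMod p)] =
      (PowerSeries.X ^ p ^ (n - 1) : PowerSeries (Polynomial (ZMod p))) := by
  have h := congrArg (PowerSeries.map (Polynomial.mapRingHom PadicInt.toZMod))
    (nSeries_liftedLaw_add hp2 hn)
  rwa [map_subst_pair' _ (constantCoeff_nSeries _ _) (constantCoeff_topTerm p n _),
    map_subst_pair' _ (by simp) (constantCoeff_X_pow_pow p _), map_nSeries, map_topTerm,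
    map_natCast_mul_X, map_X_pow, ← FormalGroup.map_toPowerSeries, liftedLaw_map_toZMod,
    (reducedLaw p n).zero_add
      (PowerSeries.HasSubst.of_constantCoeff_zero' (constantCoeff_X_pow_pow p _))] at h

/-- Modulo `p` the summand `p t` disappears. In this solved form both remaining arguments are series
in `t^q`, which gives the factor `u`. -/
lemma nSeries_reducedLaw (hp2 : p ≠ 2) (hn : 1 < n) : nSeries (reducedLaw p n) p =
    (reducedLaw p n).toPowerSeries.subst
      ![(PowerSeries.X ^ p ^ (n - 1) : PowerSeries (Polynomial (ZMod p))),
        -topTerm p n (ZMod p)] := by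
  have h := congrArg (PowerSeries.map (Polynomial.mapRingHom PadicInt.toZMod))
    (nSeries_liftedLaw hp2 hn)
  have h3 : ∀ (R : Type) [CommRing R], (-topTerm p n R).constantCoeff = 0 := fun R _ => by
    rw [map_neg, constantCoeff_topTerm, neg_zero]
  have h4 := constantCoeff_subst_pair (reducedLaw p n).zero_constantCoeff
    (constantCoeff_X_pow_pow p (n - 1)) (h3 (ZMod p))
  rwa [map_subst_pair' _ (by simp) (constantCoeff_subst_pair (liftedLaw p n).zero_constantCoeff
      (constantCoeff_X_pow_pow p _) (h3 _)), map_subst_pair' _ (constantCoeff_X_pow_pow p _) (h3 _),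
    map_nSeries, map_neg, map_topTerm, map_natCast_mul_X, map_X_pow,
    ← FormalGroup.map_toPowerSeries, liftedLaw_map_toZMod,
    (reducedLaw p n).zero_add (PowerSeries.HasSubst.of_constantCoeff_zero h4)] at h

/-- The proof by logarithms works only on the lift, so the property is transported from there by
reduction modulo `p`. -/
lemma isHom_nSeries_reducedLaw :
    IsHom (reducedLaw p n) (reducedLaw p n) (nSeries (reducedLaw p n) p) := by
  have := ((isLogOf_liftedLaw p n).isHom_nSeries (rational_injective p) p).map
    (Polynomial.mapRingHom PadicInt.toZMod)
  rwa [map_nSeries, liftedLaw_map_toZMod] at this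

end PSeries

/-! ### The factorisation `[p](t) = u(t^q)` -/

section Factor

/-- The linear coefficient of `F(t, b(t))`, for `b` divisible by `t²`. -/
lemma coeff_one_subst_X_mul {R : Type*} [CommRing R] (F : FormalGroup R) {r : ℕ} (hr : 1 < r)
    (b : PowerSeries R) : PowerSeries.coeff 1
      (F.toPowerSeries.subst ![(PowerSeries.X : PowerSeries R), b * PowerSeries.X ^ r]) = 1 := by
  have hb : (b * PowerSeries.X ^ r : PowerSeries R).constantCoeff = 0 := by
    rw [map_mul, map_pow, PowerSeries.constantCoeff_X, zero_pow (by omega), mul_zero]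
  rw [PowerSeries.coeff, MvPowerSeries.coeff_subst (hasSubst_pair PowerSeries.constantCoeff_X hb),
    finsum_eq_single _ (Finsupp.single 0 1)]
  · simp [F.lin_coeff_X]
  · intro d hd
    change _ • PowerSeries.coeff 1 _ = 0
    rw [Finsupp.prod_fintype _ _ (by simp), Fin.prod_univ_two]
    simp only [Matrix.cons_val_zero, Matrix.cons_val_one]
    -- A monomial containing the second argument has order at least `r > 1` in `t`, so only the
    -- linear term in the first argument contributes.
    by_cases h1 : d 1 = 0
    · rw [h1, pow_zero, mul_one, PowerSeries.coeff_X_pow]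
      split_ifs with h0
      · refine absurd ?_ hd
        ext i
        fin_cases i <;> simp [h1, ← h0]
      · rw [smul_zero]
    · rw [mul_pow, ← pow_mul, ← mul_assoc, PowerSeries.coeff_mul_X_pow', if_neg, smul_zero]
      have := Nat.le_mul_of_pos_right r (Nat.pos_of_ne_zero h1)
      omega

variable (p n : ℕ) [Fact p.Prime]

/-- The series `u(t) = F₀(t, -x^((p-1)q) t^p)`. -/
noncomputable def reducedFactor : PowerSeries (Polynomial (ZMod p)) :=
  (reducedLaw p n).toPowerSeries.subst ![(PowerSeries.X : PowerSeries (Polynomial (ZMod p))),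
    -PowerSeries.C (Polynomial.X ^ ((p - 1) * p ^ (n - 1))) * PowerSeries.X ^ p]

lemma constantCoeff_reducedFactor_term : (-PowerSeries.C (Polynomial.X ^ ((p - 1) * p ^ (n - 1))) *
    PowerSeries.X ^ p : PowerSeries (Polynomial (ZMod p))).constantCoeff = 0 := by
  rw [map_mul, map_pow _ PowerSeries.X, PowerSeries.constantCoeff_X,
    zero_pow (Fact.out : p.Prime).ne_zero, mul_zero]

lemma constantCoeff_reducedFactor : (reducedFactor p n).constantCoeff = 0 :=
  constantCoeff_subst_pair (reducedLaw p n).zero_constantCoeff PowerSeries.constantCoeff_X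
    (constantCoeff_reducedFactor_term p n)

lemma coeff_one_reducedFactor : (reducedFactor p n).coeff 1 = 1 :=
  coeff_one_subst_X_mul _ (Fact.out : p.Prime).one_lt _

/-- The second argument of `F₀` carries a positive power of `x`, hence vanishes when `x ↦ 0`. So the
reduction `t` is compatible with the twisted equation. -/
lemma map_reducedFactor {S : Type*} [CommRing S] {f : Polynomial (ZMod p) →+* S}
    (hf : f Polynomial.X = 0) : (reducedFactor p n).map f = PowerSeries.X := by
  have hp := (Fact.out : p.Prime).one_lt
  have hN : (p - 1) * p ^ (n - 1) ≠ 0 :=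
    mul_ne_zero (by omega) (pow_pos (by omega) _).ne'
  rw [reducedFactor, map_subst_pair' _ PowerSeries.constantCoeff_X
    (constantCoeff_reducedFactor_term p n), map_mul, map_neg, PowerSeries.map_C, map_pow f, hf,
    zero_pow hN, map_zero, neg_zero, zero_mul, PowerSeries.map_X, ← FormalGroup.map_toPowerSeries]
  exact FormalGroup.add_zero _ PowerSeries.HasSubst.X'

variable {p n}

lemma nSeries_reducedLaw_eq_subst (hp2 : p ≠ 2) (hn : 1 < n) : nSeries (reducedLaw p n) p =
    (reducedFactor p n).subst (PowerSeries.X ^ p ^ (n - 1) : PowerSeries (Polynomial (ZMod p))) := by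
  have hX := PowerSeries.HasSubst.of_constantCoeff_zero'
    (constantCoeff_X_pow_pow p (R := Polynomial (ZMod p)) (n - 1))
  rw [nSeries_reducedLaw hp2 hn, reducedFactor, PowerSeries.subst_def, subst_subst_pair
    PowerSeries.constantCoeff_X (constantCoeff_reducedFactor_term p n) hX.const]
  simp only [← PowerSeries.subst_def]
  rw [PowerSeries.subst_X hX, PowerSeries.subst_mul hX, PowerSeries.subst_pow hX,
    PowerSeries.subst_X hX, ← map_neg, PowerSeries.subst_C, topTerm, ← pow_mul, ← pow_succ,
    Nat.sub_add_cancel hn.le, map_neg, neg_mul]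
  rfl

end Factor

/-! ### Frobenius twists -/

section Frobenius

variable {R : Type*} [CommRing R] {τ : Type*}

lemma expand_injective {q : ℕ} (hq : q ≠ 0) :
    Function.Injective (MvPowerSeries.expand (σ := τ) (R := R) q hq) := fun G H h => by
  ext d
  rw [← coeff_expand_smul q hq, h, coeff_expand_smul]

lemma expand_eq_subst {q : ℕ} (hq : q ≠ 0) (G : MvPowerSeries τ R) :
    MvPowerSeries.expand q hq G = G.subst fun i => (X i : MvPowerSeries τ R) ^ q :=
  substAlgHom_apply (HasSubst.X_pow hq) G

lemma ps_expand_eq_subst {q : ℕ} (hq : q ≠ 0) (G : PowerSeries R) :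
    MvPowerSeries.expand (σ := Unit) q hq G = G.subst (PowerSeries.X ^ q : PowerSeries R) :=
  expand_eq_subst hq G

variable {p : ℕ} [ExpChar R p] (h : ℕ) {F G : FormalGroup R} {u : PowerSeries R}

/-- A homomorphism between formal group laws with `p`-series `u(t^q)` and `t^q` satisfies
`φ(u(t)) = φ^{(q)}(t)`. -/
theorem IsHom.subst_eq_map (hp : p ≠ 0) (u0 : u.constantCoeff = 0)
    (hF : nSeries F p = u.subst (PowerSeries.X ^ p ^ h : PowerSeries R))
    (hG : nSeries G p = PowerSeries.X ^ p ^ h) {φ : PowerSeries R} (hφ : IsHom F G φ) :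
    φ.subst u = φ.map (iterateFrobenius R p h) := by
  have hq : p ^ h ≠ 0 := pow_ne_zero h hp
  -- The equation is checked after `t ↦ t^q`. There it becomes `φ([p]_F(t)) = [p]_G(φ(t)) = φ(t)^q`,
  -- and the last term is `φ^{(q)}(t^q)`.
  apply expand_injective (pow_ne_zero h hp)
  rw [ps_expand_eq_subst, PowerSeries.subst_comp_subst_apply
    (PowerSeries.HasSubst.of_constantCoeff_zero' u0) (PowerSeries.HasSubst.X_pow hq), ← hF,
    hφ.subst_nSeries, hG, PowerSeries.subst_pow (PowerSeries.HasSubst.of_constantCoeff_zero' hφ.1),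
    PowerSeries.subst_X (PowerSeries.HasSubst.of_constantCoeff_zero' hφ.1)]
  refine (map_iterateFrobenius_expand p hp φ h).symm.trans ?_
  exact map_expand _ _ _ _

/-- If `[p]_F(t) = u(t^q)` is an endomorphism, then `u` is a homomorphism `F^{(q)} → F`. -/
theorem IsHom.of_nSeries (hp : p ≠ 0) (u0 : u.constantCoeff = 0)
    (hF : nSeries F p = u.subst (PowerSeries.X ^ p ^ h : PowerSeries R))
    (hhom : IsHom F F (nSeries F p)) : IsHom (F.map (iterateFrobenius R p h)) F u := by
  have hq : p ^ h ≠ 0 := pow_ne_zero h hp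
  have hX : ∀ i : Fin 2, (X i : MvPowerSeries (Fin 2) R).constantCoeff = 0 := fun i => by simp
  have huX : ∀ i : Fin 2, (u.subst (X i : MvPowerSeries (Fin 2) R)).constantCoeff = 0 :=
    fun i => PowerSeries.constantCoeff_subst_eq_zero (hX i) _ u0
  have hXq := HasSubst.X_pow (σ := Fin 2) (S := R) hq
  have hcomp : ∀ {a : MvPowerSeries (Fin 2) R}, a.constantCoeff = 0 →
      (nSeries F p).subst a = u.subst (a ^ p ^ h) := fun {a} ha => by
    have ha' := PowerSeries.HasSubst.of_constantCoeff_zero ha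
    rw [hF, PowerSeries.subst_comp_subst_apply (PowerSeries.HasSubst.X_pow hq) ha',
      PowerSeries.subst_pow ha', PowerSeries.subst_X ha']
  refine ⟨u0, expand_injective (pow_ne_zero h hp) ?_⟩
  have h2 := hhom.2
  -- Since `F(X, Y)^q = F^{(q)}(X^q, Y^q)`, the endomorphism property of `[p]_F` is the wanted
  -- identity with `X^q`, `Y^q` for `X`, `Y`, and `expand` is injective.
  rw [hcomp F.zero_constantCoeff, hcomp (hX 0), hcomp (hX 1),
    ← map_iterateFrobenius_expand p hp, map_expand, expand_eq_subst] at h2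
  rw [expand_eq_subst, expand_eq_subst, subst_subst_single (F.map _).zero_constantCoeff hXq,
    subst_subst_pair (huX 0) (huX 1) hXq, subst_subst_single (hX 0) hXq,
    subst_subst_single (hX 1) hXq, subst_X hXq, subst_X hXq]
  exact h2

end Frobenius

/-! ### Homomorphisms from `F₀` to `H` over `𝔽_p`-algebras -/

section BaseChangedLaws

variable {p n : ℕ} [Fact p.Prime]

/-- At `x = 0` the value of `vₙ` becomes zero. Thus `F₀` deforms `H`, and the `p`-series of `H` is a
specialisation of that of `F₀`. -/
lemma reducedLaw_map_eval : (reducedLaw p n).map (Polynomial.evalRingHom 0) =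
    hondaLaw p (n - 1) := by
  have hp := (Fact.out : p.Prime).one_lt
  have hN : (p - 1) * p ^ (n - 1) ≠ 0 :=
    mul_ne_zero (by omega) (pow_pos (by omega) _).ne'
  rw [reducedLaw, hondaLaw, arakiLawMod, arakiLawMod, formalGroup_map_map]
  congr 1
  refine MvPolynomial.ringHom_ext (fun a => ?_) fun i => ?_
  · simp
  · simp only [RingHom.comp_apply, MvPolynomial.coe_eval₂Hom, MvPolynomial.eval₂_X]
    split_ifs <;> simp [hN]

/-- The `p`-series of the Honda formal group law. -/
theorem nSeries_hondaLaw (hp2 : p ≠ 2) (hn : 1 < n) :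
    nSeries (hondaLaw p (n - 1)) p = PowerSeries.X ^ p ^ (n - 1) := by
  have hX := constantCoeff_X_pow_pow p (R := Polynomial (ZMod p)) (n - 1)
  rw [← reducedLaw_map_eval, ← map_nSeries, nSeries_reducedLaw_eq_subst hp2 hn]
  refine (map_subst_single (τ := Unit) _ hX _).trans ?_
  rw [map_reducedFactor p n (by simp)]
  refine (PowerSeries.subst_X (PowerSeries.HasSubst.of_constantCoeff_zero
    (by rw [constantCoeff_map]; exact (congrArg _ hX).trans (map_zero _)))).trans ?_
  exact map_X_pow _ _

variable {R : Type*} [CommRing R]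

lemma nSeries_reducedLaw_map (hp2 : p ≠ 2) (hn : 1 < n) (f : Polynomial (ZMod p) →+* R) :
    nSeries ((reducedLaw p n).map f) p =
      ((reducedFactor p n).map f).subst (PowerSeries.X ^ p ^ (n - 1) : PowerSeries R) := by
  have hX := constantCoeff_X_pow_pow p (R := Polynomial (ZMod p)) (n - 1)
  rw [← map_nSeries, nSeries_reducedLaw_eq_subst hp2 hn]
  refine (map_subst_single (τ := Unit) _ hX _).trans ?_
  congr 1
  exact map_X_pow _ _

lemma isHom_reducedFactor [ExpChar R p] (hp2 : p ≠ 2) (hn : 1 < n)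
    (f : Polynomial (ZMod p) →+* R) :
    IsHom (((reducedLaw p n).map f).map (iterateFrobenius R p (n - 1))) ((reducedLaw p n).map f)
      ((reducedFactor p n).map f) := by
  refine IsHom.of_nSeries (n - 1) (Fact.out : p.Prime).ne_zero
    (by rw [constantCoeff_ps_map, constantCoeff_reducedFactor, map_zero])
    (nSeries_reducedLaw_map hp2 hn f) ?_
  rw [← map_nSeries]
  exact isHom_nSeries_reducedLaw.map f

variable [Algebra (ZMod p) R]

lemma nSeries_hondaLawOver (hp2 : p ≠ 2) (hn : 1 < n) :
    nSeries (hondaLawOver p R (n - 1)) p = PowerSeries.X ^ p ^ (n - 1) := by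
  rw [hondaLawOver, ← map_nSeries, nSeries_hondaLaw hp2 hn, map_X_pow]

lemma hondaLawOver_map {S : Type*} [CommRing S] [Algebra (ZMod p) S] (f : R →+* S) (h : ℕ) :
    (hondaLawOver p R h).map f = hondaLawOver p S h := by
  rw [hondaLawOver, hondaLawOver, formalGroup_map_map]
  congr 1
  exact RingHom.ext_zmod _ _

lemma reducedLaw_map_eq_hondaLawOver {f : Polynomial (ZMod p) →+* R} (hf : f Polynomial.X = 0) :
    (reducedLaw p n).map f = hondaLawOver p R (n - 1) := by
  rw [hondaLawOver, ← reducedLaw_map_eval, formalGroup_map_map]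
  congr 1
  refine Polynomial.ringHom_ext (fun a => ?_) (by simp [hf])
  exact congrFun (congrArg DFunLike.coe (RingHom.ext_zmod (f.comp Polynomial.C)
    (((algebraMap (ZMod p) R).comp (Polynomial.evalRingHom 0)).comp Polynomial.C))) a

/-- Homomorphisms from `F₀` to the Honda formal group law satisfy a twisted equation. -/
theorem IsHom.subst_reducedFactor [ExpChar R p] (hp2 : p ≠ 2) (hn : 1 < n)
    {f : Polynomial (ZMod p) →+* R} {φ : PowerSeries R}
    (hφ : IsHom ((reducedLaw p n).map f) (hondaLawOver p R (n - 1)) φ) :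
    φ.subst ((reducedFactor p n).map f) = φ.map (iterateFrobenius R p (n - 1)) :=
  hφ.subst_eq_map (n - 1) (Fact.out : p.Prime).ne_zero
    (by rw [constantCoeff_ps_map, constantCoeff_reducedFactor, map_zero])
    (nSeries_reducedLaw_map hp2 hn f) (nSeries_hondaLawOver hp2 hn)

/-- If `a^q - a = b` has a unique solution in the kernel of `κ`, for `b` in this kernel, then there
is a strict isomorphism from `F₀` to the Honda formal group law that reduces to `t` along `κ`. -/
theorem exists_isStrictIso [ExpChar R p] (hp2 : p ≠ 2) (hn : 1 < n) {k : Type*} [CommRing k]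
    [Algebra (ZMod p) k] {κ : R →+* k} (hinj : ∀ a, κ a = 0 → a ^ p ^ (n - 1) = a → a = 0)
    (hsol : ∀ b, κ b = 0 → ∃ a, κ a = 0 ∧ a ^ p ^ (n - 1) - a = b)
    {f : Polynomial (ZMod p) →+* R} (hf : κ (f Polynomial.X) = 0) :
    ∃ φ : PowerSeries R,
      IsStrictIso ((reducedLaw p n).map f) (hondaLawOver p R (n - 1)) φ ∧
        φ.map κ = PowerSeries.X := by
  have hf' : (κ.comp f) Polynomial.X = 0 := hf
  have u0 : ((reducedFactor p n).map f).constantCoeff = 0 := by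
    rw [constantCoeff_ps_map, constantCoeff_reducedFactor, map_zero]
  have u1 : ((reducedFactor p n).map f).coeff 1 = 1 := by
    rw [PowerSeries.coeff_map, coeff_one_reducedFactor, map_one]
  have uκ : ((reducedFactor p n).map f).map κ = PowerSeries.X := by
    rw [← map_reducedFactor p n hf', PowerSeries.map_comp]
    rfl
  obtain ⟨φ, h0, h1, hφκ, hφ⟩ := exists_subst_eq_map (σ := iterateFrobenius R p (n - 1))
    (by simpa only [iterateFrobenius_def] using hsol) u0 u1 uκ
  refine ⟨φ, IsHom.isStrictIso ?_ h1, hφκ⟩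
  refine isHom_of_subst_eq_map (κ := κ) (by simpa only [iterateFrobenius_def] using hinj) ?_ ?_ u1
    (isHom_reducedFactor hp2 hn f) h0 hφκ hφ
  · rw [formalGroup_map_map, reducedLaw_map_eq_hondaLawOver hf', hondaLawOver_map]
  -- `H` is defined over `𝔽_p`, so the Frobenius twist does not change it.
  · exact hondaLawOver_map _ _

theorem eq_of_isHom [ExpChar R p] (hp2 : p ≠ 2) (hn : 1 < n) {k : Type*} [CommRing k]
    {κ : R →+* k} (hinj : ∀ a, κ a = 0 → a ^ p ^ (n - 1) = a → a = 0)
    {f : Polynomial (ZMod p) →+* R} {φ ψ : PowerSeries R}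
    (hφ : IsHom ((reducedLaw p n).map f) (hondaLawOver p R (n - 1)) φ)
    (hψ : IsHom ((reducedLaw p n).map f) (hondaLawOver p R (n - 1)) ψ)
    (h : φ.map κ = ψ.map κ) : φ = ψ :=
  eq_of_subst_eq_map (σ := iterateFrobenius R p (n - 1))
    (by simpa only [iterateFrobenius_def] using hinj)
    (by rw [constantCoeff_ps_map, constantCoeff_reducedFactor, map_zero])
    (by rw [PowerSeries.coeff_map, coeff_one_reducedFactor, map_one])
    (hφ.subst_reducedFactor hp2 hn) (hψ.subst_reducedFactor hp2 hn) h

end BaseChangedLaws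

/-! ### Artin–Schreier equations -/

section ArtinSchreier

variable {p : ℕ} [Fact p.Prime]

/-- Frobenius is the identity on `𝔽_p`, so `g(x)^(p^h) = g(x^(p^h))`. -/
lemma coeff_pow_pow_zmod (g : PowerSeries (ZMod p)) {h : ℕ} (m : ℕ) :
    (g ^ p ^ h).coeff m = if p ^ h ∣ m then g.coeff (m / p ^ h) else 0 := by
  have hp : p ≠ 0 := (Fact.out : p.Prime).ne_zero
  have h1 := map_iterateFrobenius_expand (σ := Unit) (R := ZMod p) p hp g h
  rw [RingHom.ext_zmod (iterateFrobenius (ZMod p) p h) (RingHom.id _), MvPowerSeries.map_id,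
    RingHom.id_apply, ps_expand_eq_subst] at h1
  have h2 := PowerSeries.coeff_subst_X_pow (S := ZMod p) (pow_ne_zero h hp) g m
  rw [h1] at h2
  exact h2

lemma exists_pow_sub_eq {h : ℕ} (hh : h ≠ 0) {b : PowerSeries (ZMod p)}
    (hb : b.constantCoeff = 0) :
    ∃ a : PowerSeries (ZMod p), a.constantCoeff = 0 ∧ a ^ p ^ h - a = b := by
  have hq : 1 < p ^ h := Nat.one_lt_pow hh (Fact.out : p.Prime).one_lt
  -- With `Q = p^h`, these are the coefficients of `-(b + b^Q + b^(Q²) + ⋯)`, which converges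
  -- because `b` has no constant term. The index `0` is excluded from the recursion since `0 / Q` is
  -- not smaller than `0`.
  obtain ⟨a, ha⟩ : ∃ a : ℕ → ZMod p, ∀ m, a m =
      if hm : p ^ h ∣ m ∧ m ≠ 0 then a (m / p ^ h) - b.coeff m else -b.coeff m := by
    let a : ℕ → ZMod p := fun m => Nat.strongRec (fun m ih =>
      if hm : p ^ h ∣ m ∧ m ≠ 0 then
        ih (m / p ^ h) (Nat.div_lt_self (Nat.pos_of_ne_zero hm.2) hq) - b.coeff m
      else -b.coeff m) m
    exact ⟨a, fun m => Nat.strongRec.eq_1 _ _⟩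
  have a0 : a 0 = 0 := by
    rw [ha, dif_neg (by simp), PowerSeries.coeff_zero_eq_constantCoeff_apply, hb, neg_zero]
  refine ⟨PowerSeries.mk a, by simp [a0], ?_⟩
  ext m
  rw [map_sub, coeff_pow_pow_zmod, PowerSeries.coeff_mk, PowerSeries.coeff_mk, sub_eq_iff_eq_add]
  rcases eq_or_ne m 0 with rfl | hm
  · simp [a0, hb]
  · rw [ha m]
    split_ifs with h1 h2 h2
    · ring
    · exact absurd ⟨h1, hm⟩ h2
    · exact absurd h2.1 h1
    · ring

/-- In the domain `𝔽_p[[x]]`, a nonzero `a` would satisfy `a^(p^h - 1) = 1`, which fails at the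
constant term. -/
lemma eq_zero_of_pow_eq_self {h : ℕ} (hh : h ≠ 0) {a : PowerSeries (ZMod p)}
    (ha : a.constantCoeff = 0) (hpow : a ^ p ^ h = a) : a = 0 := by
  have hq : 1 < p ^ h := Nat.one_lt_pow hh (Fact.out : p.Prime).one_lt
  have h1 : a * (a ^ (p ^ h - 1) - 1) = 0 := by
    rw [mul_sub, ← pow_succ', Nat.sub_add_cancel hq.le, hpow, mul_one, sub_self]
  refine (mul_eq_zero.mp h1).resolve_right fun h2 => ?_
  have h3 := congrArg PowerSeries.constantCoeff h2
  rw [map_sub, map_pow, ha, zero_pow (by omega), map_one, map_zero, zero_sub] at h3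
  exact one_ne_zero (neg_eq_zero.mp h3)

/-- The roots of an Artin–Schreier polynomial lie in the image of a separably closed field. -/
lemma exists_map_eq_of_pow_sub_eq {K L : Type*} [Field K] [Field L] [IsSepClosed K] [CharP K p]
    (ι : K →+* L) {h : ℕ} (hh : h ≠ 0) {r : K} {a : L} (ha : a ^ p ^ h - a = ι r) :
    ∃ s, ι s = a ∧ s ^ p ^ h - s = r := by
  have hq : 1 < p ^ h := Nat.one_lt_pow hh (Fact.out : p.Prime).one_lt
  set P : Polynomial K := Polynomial.X ^ p ^ h - Polynomial.X - Polynomial.C r with hP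
  have hdeg : (Polynomial.X + Polynomial.C r : Polynomial K).degree < (p ^ h : ℕ) :=
    lt_of_le_of_lt (Polynomial.degree_X_add_C r).le (by exact_mod_cast hq)
  have hmonic : P.Monic := by
    rw [hP, sub_sub]
    exact Polynomial.monic_X_pow_sub (by simpa using hdeg)
  have hsep : P.Separable := by
    have hder : Polynomial.derivative P = -1 := by
      rw [hP, Polynomial.derivative_sub, Polynomial.derivative_sub, Polynomial.derivative_X_pow,
        Nat.cast_pow, CharP.cast_eq_zero, zero_pow hh, map_zero, zero_mul, Polynomial.derivative_X,
        Polynomial.derivative_C, zero_sub, sub_zero]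
    rw [Polynomial.Separable, hder]
    exact (isCoprime_one_right (x := P)).neg_right
  have hsplit := IsSepClosed.splits_of_separable P hsep
  have hroot : (P.map ι).IsRoot a := by
    simp [hP, ← ha]
  -- `P` has derivative `-1`, so it is separable and splits over `K`. Every root in `L` is therefore
  -- the image of a root in `K`.
  have hmem : a ∈ (P.map ι).roots := (Polynomial.mem_roots (hmonic.map ι).ne_zero).mpr hroot
  rw [hsplit.roots_map ι, Multiset.mem_map] at hmem
  obtain ⟨s, hs, rfl⟩ := hmem
  refine ⟨s, rfl, ι.injective ?_⟩
  rw [map_sub, map_pow, ha]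

end ArtinSchreier

/-! ### The ring of algebraic functions with an expansion in `𝔽_p[[y⁻¹]]` -/

section ExpansionRing

variable {p : ℕ} [Fact p.Prime]

/-- The inclusion of `𝔽_p[[x]]` in the separable closure of `𝔽_p((x))`. -/
noncomputable def powerSeriesToSep (p : ℕ) [Fact p.Prime] : PowerSeries (ZMod p) →+* LaurentSep p :=
  (algebraMap (LaurentSeries (ZMod p)) (LaurentSep p)).comp (HahnSeries.ofPowerSeries ℤ (ZMod p))

lemma powerSeriesToSep_injective : Function.Injective (powerSeriesToSep p) :=
  (algebraMap (LaurentSeries (ZMod p)) (LaurentSep p)).injective.comp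
    HahnSeries.ofPowerSeries_injective

/-- The ring of elements of `𝔽_p(y)^s` with an expansion in `𝔽_p[[y⁻¹]]`, paired with this
expansion. -/
noncomputable def expansionRing (ι : RatSep p →+* LaurentSep p) :
    Subring (RatSep p × PowerSeries (ZMod p)) :=
  RingHom.eqLocus (ι.comp (RingHom.fst _ _)) ((powerSeriesToSep p).comp (RingHom.snd _ _))

variable (ι : RatSep p →+* LaurentSep p)

/-- The inclusion of the expansion ring in `𝔽_p(y)^s`. -/
noncomputable def expansionFst : expansionRing ι →+* RatSep p :=
  (RingHom.fst _ _).comp (expansionRing ι).subtype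

/-- The expansion map on the expansion ring. -/
noncomputable def expansionSnd : expansionRing ι →+* PowerSeries (ZMod p) :=
  (RingHom.snd _ _).comp (expansionRing ι).subtype

lemma map_expansionFst (a : expansionRing ι) :
    ι (expansionFst ι a) = powerSeriesToSep p (expansionSnd ι a) := a.2

variable {ι}

/-- Both maps to `LaurentSep p` are injective, so either component of a pair determines the other.
Equations in this ring can thus be checked on expansions. -/
lemma expansionRing_ext {a b : expansionRing ι} (h : expansionSnd ι a = expansionSnd ι b) :
    a = b := by
  refine Subtype.ext (Prod.ext (ι.injective ?_) h)
  exact (map_expansionFst ι a).trans ((congrArg _ h).trans (map_expansionFst ι b).symm)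

lemma expansionSnd_injective : Function.Injective (expansionSnd ι) := fun _ _ => expansionRing_ext

lemma expansionFst_injective : Function.Injective (expansionFst ι) := fun a b h =>
  expansionRing_ext (powerSeriesToSep_injective (by
    rw [← map_expansionFst, ← map_expansionFst, h]))

instance : CharP (expansionRing ι) p :=
  have : CharP (PowerSeries (ZMod p)) p :=
    charP_of_injective_ringHom (f := PowerSeries.C) PowerSeries.C_injective p
  (expansionSnd ι).charP expansionSnd_injective p

noncomputable instance : Algebra (ZMod p) (expansionRing ι) := ZMod.algebra _ p

variable (ι) in
/-- The constant coefficient of the expansion. -/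
noncomputable def expansionConst : expansionRing ι →+* ZMod p :=
  PowerSeries.constantCoeff.comp (expansionSnd ι)

lemma expansionRing_eq_zero {h : ℕ} (hh : h ≠ 0) {a : expansionRing ι}
    (ha : expansionConst ι a = 0) (hpow : a ^ p ^ h = a) : a = 0 := by
  apply expansionSnd_injective
  rw [map_zero]
  exact eq_zero_of_pow_eq_self hh ha (by rw [← map_pow, hpow])

/-- The equation is solved by a power series `g`. Its image in `LaurentSep p` is a root of an
Artin–Schreier polynomial coming from `𝔽_p(y)^s`, hence lies in the image of that field. -/
lemma expansionRing_exists_pow_sub_eq {h : ℕ} (hh : h ≠ 0) {b : expansionRing ι}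
    (hb : expansionConst ι b = 0) :
    ∃ a, expansionConst ι a = 0 ∧ a ^ p ^ h - a = b := by
  obtain ⟨g, g0, hg⟩ := exists_pow_sub_eq hh (b := expansionSnd ι b) hb
  have : CharP (LaurentSep p) p :=
    charP_of_injective_ringHom (f := (powerSeriesToSep p).comp PowerSeries.C)
      (powerSeriesToSep_injective.comp PowerSeries.C_injective) p
  have : CharP (RatSep p) p := ι.charP ι.injective p
  obtain ⟨s, hs, -⟩ := exists_map_eq_of_pow_sub_eq ι hh (r := expansionFst ι b)
    (a := powerSeriesToSep p g) (by rw [map_expansionFst, ← hg, map_sub, map_pow])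
  exact ⟨⟨(s, g), hs⟩, g0, expansionRing_ext (by
    rw [map_sub, map_pow]
    exact hg)⟩

/-- Expansion at infinity sends `y⁻¹` to the Laurent variable. This compatibility lets `𝔽_p[y⁻¹]`,
and with it `F₀`, map to the expansion ring. -/
lemma map_invVarToRatFunc (hι : Extends p ι (expandAtInfinity (ZMod p))) :
    ι.comp ((algebraMap (RatFunc (ZMod p)) (RatSep p)).comp (invVarToRatFunc (ZMod p))) =
      (powerSeriesToSep p).comp Polynomial.coeToPowerSeries.ringHom := by
  refine Polynomial.ringHom_ext' (RingHom.ext_zmod _ _) ?_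
  rw [← RingHom.comp_assoc, hι, RingHom.comp_assoc, powerSeriesToSep, RingHom.comp_assoc,
    RingHom.comp_apply, RingHom.comp_apply (algebraMap _ _)]
  congr 1
  rw [RingHom.comp_apply, RingHom.comp_apply, invVarToRatFunc, AlgHom.toRingHom_eq_coe,
    RingHom.coe_coe, Polynomial.aeval_X, map_inv₀, expandAtInfinity, expandAlong_X]
  simp [HahnSeries.inv_single]

/-- The inclusion of `𝔽_p[y⁻¹]` in the expansion ring. -/
noncomputable def polyToExpansionRing (hι : Extends p ι (expandAtInfinity (ZMod p))) :
    Polynomial (ZMod p) →+* expansionRing ι :=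
  (((algebraMap (RatFunc (ZMod p)) (RatSep p)).comp (invVarToRatFunc (ZMod p))).prod
    Polynomial.coeToPowerSeries.ringHom).codRestrict _
      fun a => congrFun (congrArg DFunLike.coe (map_invVarToRatFunc hι)) a

lemma expansionConst_polyToExpansionRing (hι : Extends p ι (expandAtInfinity (ZMod p))) :
    expansionConst ι (polyToExpansionRing hι Polynomial.X) = 0 := by
  change PowerSeries.constantCoeff (Polynomial.coeToPowerSeries.ringHom Polynomial.X) = 0
  simp

variable {n : ℕ}

lemma reducedLaw_map_fst (hι : Extends p ι (expandAtInfinity (ZMod p))) :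
    ((reducedLaw p n).map (polyToExpansionRing hι)).map (expansionFst ι) =
      reducedLawRatSep p n := formalGroup_map_map _ _ _

lemma reducedLaw_map_snd (hι : Extends p ι (expandAtInfinity (ZMod p))) :
    ((reducedLaw p n).map (polyToExpansionRing hι)).map (expansionSnd ι) =
      reducedLawPowerSeries p n := formalGroup_map_map _ _ _

/-- A power series with an expansion comes from the expansion ring. -/
lemma IsUnipotentExpansion.exists_lift {Φ : PowerSeries (RatSep p)}
    {φ : PowerSeries (PowerSeries (ZMod p))} (h : IsUnipotentExpansion ι Φ φ) :
    ∃ θ : PowerSeries (expansionRing ι), θ.map (expansionFst ι) = Φ ∧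
      θ.map (expansionConst ι) = PowerSeries.X := by
  have hc : ∀ m, ι (Φ.coeff m) = powerSeriesToSep p (φ.coeff m) := fun m => by
    have := congrArg (PowerSeries.coeff m) h.1
    rwa [PowerSeries.coeff_map, PowerSeries.coeff_map] at this
  refine ⟨PowerSeries.mk fun m => ⟨(Φ.coeff m, φ.coeff m), hc m⟩, ?_, ?_⟩
  · ext m
    rw [PowerSeries.coeff_map, PowerSeries.coeff_mk]
    rfl
  · refine Eq.trans (PowerSeries.ext fun m => ?_) h.2
    rw [PowerSeries.coeff_map, PowerSeries.coeff_mk]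
    exact (PowerSeries.coeff_map PowerSeries.constantCoeff m φ).symm

lemma isUnipotentExpansion_map {θ : PowerSeries (expansionRing ι)}
    (hθ : θ.map (expansionConst ι) = PowerSeries.X) :
    IsUnipotentExpansion ι (θ.map (expansionFst ι)) (θ.map (expansionSnd ι)) := by
  refine ⟨PowerSeries.ext fun m => ?_, ?_⟩
  · simp only [PowerSeries.coeff_map]
    exact map_expansionFst ι _
  · refine Eq.trans (PowerSeries.ext fun m => ?_) hθ
    simp only [PowerSeries.coeff_map]
    rfl

/-- There is at most one homomorphism from `F₀` to the Honda formal group law with a unipotent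
expansion. -/
theorem IsUnipotentExpansion.eq_of_isHom (hp2 : p ≠ 2) (hn : 1 < n)
    (hι : Extends p ι (expandAtInfinity (ZMod p))) {Φ Φ' : PowerSeries (RatSep p)}
    {φ φ' : PowerSeries (PowerSeries (ZMod p))} (h : IsUnipotentExpansion ι Φ φ)
    (h' : IsUnipotentExpansion ι Φ' φ')
    (hΦ : IsHom (reducedLawRatSep p n) (hondaLawOver p (RatSep p) (n - 1)) Φ)
    (hΦ' : IsHom (reducedLawRatSep p n) (hondaLawOver p (RatSep p) (n - 1)) Φ') : Φ' = Φ := by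
  obtain ⟨θ, rfl, hθ⟩ := h.exists_lift
  obtain ⟨θ', rfl, hθ'⟩ := h'.exists_lift
  rw [← reducedLaw_map_fst hι, ← hondaLawOver_map (expansionFst ι)] at hΦ hΦ'
  -- The lifts to the expansion ring are again homomorphisms since `expansionFst` is injective, and
  -- both reduce to `t` along the constant term.
  rw [ChromaticFGL.eq_of_isHom hp2 hn (κ := expansionConst ι)
    (fun a => expansionRing_eq_zero (by omega)) (hΦ'.of_map expansionFst_injective)
    (hΦ.of_map expansionFst_injective) (hθ'.trans hθ.symm)]

/-- There is a strict isomorphism from `F₀` to the Honda formal group law with a unipotent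
expansion. -/
theorem exists_isUnipotentExpansion (hp2 : p ≠ 2) (hn : 1 < n)
    (hι : Extends p ι (expandAtInfinity (ZMod p))) :
    ∃ (Φ : PowerSeries (RatSep p)) (φ : PowerSeries (PowerSeries (ZMod p))),
      IsStrictIso (reducedLawRatSep p n) (hondaLawOver p (RatSep p) (n - 1)) Φ ∧
      IsUnipotentExpansion ι Φ φ ∧
      IsStrictIso (reducedLawPowerSeries p n) (hondaLawOver p (PowerSeries (ZMod p)) (n - 1)) φ := by
  obtain ⟨θ, hθ, hθκ⟩ := exists_isStrictIso hp2 hn (κ := expansionConst ι)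
    (fun a => expansionRing_eq_zero (by omega))
    (fun b => expansionRing_exists_pow_sub_eq (by omega)) (expansionConst_polyToExpansionRing hι)
  refine ⟨_, _, ?_, isUnipotentExpansion_map hθκ, ?_⟩
  · rw [← reducedLaw_map_fst hι, ← hondaLawOver_map (expansionFst ι)]
    exact (hθ.1.1.map _).isStrictIso (by rw [PowerSeries.coeff_map, hθ.2, map_one])
  · rw [← reducedLaw_map_snd hι, ← hondaLawOver_map (expansionSnd ι)]
    exact (hθ.1.1.map _).isStrictIso (by rw [PowerSeries.coeff_map, hθ.2, map_one])

/-- Needed to move homomorphisms between the two separable closures: `ι₀` extends the expansion at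
zero, so the two base changes of `F₀` match. -/
lemma reducedLawRatSep_map {ι₀ : RatSep p →+* LaurentSep p}
    (hι₀ : Extends p ι₀ (expandAtZero (ZMod p))) :
    (reducedLawRatSep p n).map ι₀ = reducedLawLaurentSep p n := by
  rw [reducedLawRatSep, formalGroup_map_map, ← RingHom.comp_assoc, hι₀, RingHom.comp_assoc]
  rfl

end ExpansionRing

end ChromaticFGL

/-! ### The main theorem -/

theorem mainTheorem4 (p n : ℕ) [Fact p.Prime] (hp : p ≠ 2) (hn : 1 < n)
    (ι ι₀ : ChromaticFGL.RatSep p →+* ChromaticFGL.LaurentSep p)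
    (hι : ChromaticFGL.Extends p ι (ChromaticFGL.expandAtInfinity (ZMod p)))
    (hι₀ : ChromaticFGL.Extends p ι₀ (ChromaticFGL.expandAtZero (ZMod p))) :
    -- `[p](t) +_{F₀} y^((1-p)q) t^(pq) = t^q`, where `q = p^(n-1)`
    (ChromaticFGL.reducedLaw p n).toPowerSeries.subst
        ![ChromaticFGL.nSeries (ChromaticFGL.reducedLaw p n) p,
          PowerSeries.C (Polynomial.X ^ ((p - 1) * p ^ (n - 1)) : Polynomial (ZMod p)) *
            PowerSeries.X ^ (p * p ^ (n - 1))] =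
      (PowerSeries.X ^ p ^ (n - 1) : PowerSeries (Polynomial (ZMod p))) ∧
    -- `[p]_H(t) = t^q`
    ChromaticFGL.nSeries (ChromaticFGL.hondaLaw p (n - 1)) p = PowerSeries.X ^ p ^ (n - 1) ∧
    -- the isomorphism over the separable closure of `𝔽_p(y)`
    (∃ (Φ : PowerSeries (ChromaticFGL.RatSep p)) (φ : PowerSeries (PowerSeries (ZMod p))),
      ChromaticFGL.IsStrictIso (ChromaticFGL.reducedLawRatSep p n)
        (ChromaticFGL.hondaLawOver p (ChromaticFGL.RatSep p) (n - 1)) Φ ∧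
      ChromaticFGL.IsUnipotentExpansion ι Φ φ ∧
      ChromaticFGL.IsStrictIso (ChromaticFGL.reducedLawPowerSeries p n)
        (ChromaticFGL.hondaLawOver p (PowerSeries (ZMod p)) (n - 1)) φ ∧
      ∀ (Φ' : PowerSeries (ChromaticFGL.RatSep p)) (φ' : PowerSeries (PowerSeries (ZMod p))),
        ChromaticFGL.IsIso (ChromaticFGL.reducedLawRatSep p n)
          (ChromaticFGL.hondaLawOver p (ChromaticFGL.RatSep p) (n - 1)) Φ' →
        ChromaticFGL.IsUnipotentExpansion ι Φ' φ' → Φ' = Φ) ∧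
    -- the isomorphism over the separable closure of `𝔽_p((y))`
    ∃! Ψ : PowerSeries (ChromaticFGL.LaurentSep p),
      ChromaticFGL.IsStrictIso (ChromaticFGL.reducedLawLaurentSep p n)
        (ChromaticFGL.hondaLawOver p (ChromaticFGL.LaurentSep p) (n - 1)) Ψ ∧
      ∃ (Φ : PowerSeries (ChromaticFGL.RatSep p)) (φ : PowerSeries (PowerSeries (ZMod p))),
        Ψ = Φ.map ι₀ ∧ ChromaticFGL.IsUnipotentExpansion ι Φ φ := by
  have hn0 : p ^ n = p * p ^ (n - 1) := by rw [← pow_succ', Nat.sub_add_cancel hn.le]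
  obtain ⟨Φ, φ, hΦ, hΦφ, hφ⟩ := ChromaticFGL.exists_isUnipotentExpansion hp hn hι
  refine ⟨?_, ChromaticFGL.nSeries_hondaLaw hp hn, ⟨Φ, φ, hΦ, hΦφ, hφ, fun Φ' φ' h h' =>
    hΦφ.eq_of_isHom hp hn hι h' hΦ.1.1 h.1⟩, Φ.map ι₀, ⟨?_, Φ, φ, rfl, hΦφ⟩, ?_⟩
  · rw [← hn0]
    exact ChromaticFGL.nSeries_reducedLaw_add hp hn
  · rw [← ChromaticFGL.reducedLawRatSep_map hι₀, ← ChromaticFGL.hondaLawOver_map ι₀]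
    exact (hΦ.1.1.map ι₀).isStrictIso (by rw [PowerSeries.coeff_map, hΦ.2, map_one])
  -- A competitor is `Φ'.map ι₀`. As `ι₀` is injective, `Φ'` is itself a homomorphism over
  -- `𝔽_p(y)^s`, and the uniqueness at infinity applies to it.
  · rintro _ ⟨hΨ, Φ', φ', rfl, h'⟩
    rw [← ChromaticFGL.reducedLawRatSep_map hι₀, ← ChromaticFGL.hondaLawOver_map ι₀] at hΨ
    rw [hΦφ.eq_of_isHom hp hn hι h' hΦ.1.1 (hΨ.1.1.of_map ι₀.injective)]
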